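/- A signed digraph is a digraph each of whose arcs carries a sign $+1$ or $-1$. Its adjacency matrix has the sign of $uv$ as its $(u,v)$ entry if $uv$ is an arc, and $0$ otherwise. Its iota energy $E_c$ is $\sum_k|\mathrm{Im}\,z_k|$, the sum running over the eigenvalues $z_k$ of this matrix with algebraic multiplicity. A directed cycle is positive or negative according to the product of the signs of its arcs; $C_r^+$ and $C_r^-$ denote a positive and a negative directed cycle on $r$ vertices. For $n\ge 4$ let $\mathcal S_n$ be the set of signed digraphs on $n$ vertices whose underlying graph is connected and which contain exactly two directed cycles, these being vertex-disjoint and of even length. Write $P(a,b)=E_c(C_a^+)+E_c(C_b^+)$ and $N(a,b)=E_c(C_a^-)+E_c(C_b^-)$. **Theorem.** For every even $r\ge2$ the values $E_c(C_r^{+})=2\cot\frac{\pi}{r}$ and $E_c(C_r^-)=2\csc\frac{\pi}{r}$ hold for every choice of the signs of the single arcs with the given product. If $S\in\mathcal S_n$ has two positive cycles of lengths $a,b$ then $E_c(S)=P(a,b)$, and if it has two negative cycles of lengths $a,b$ then $E_c(S)=N(a,b)$. These energies are ordered as follows. For even $M\ge 22$ let $h_M$ be the largest even integer with $h_M\le M/2$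 (so $h_M=M/2$ if $M/2$ is even and $h_M=M/2-1$ if $M/2$ is odd). *(i)–(iv)* Let $n\ge 22$, and let $m=n$ if $n$ is even and $m=n-1$ if $n$ is odd (the four cases are given by the parities of $n$ and of $m/2=\lfloor n/2\rfloor$). Then $$N(2,m-2)>N(4,m-4)>N(6,m-6)>\cdots>N(h_m,m-h_m)>\Sigma_m>\Sigma_{m-2}>\cdots>\Sigma_{24}>\Sigma_{22},$$ where, for each even $M$ with $22\le M\le m$, $\Sigma_M$ stands for the chain $$P(h_M,M-h_M)>P(h_M-2,M-h_M+2)>\cdots>P(6,M-6)>N(2,M-4)>P(4,M-4)$$ $$>N(4,M-6)>N(6,M-8)>\cdots>N(h_{M-2},M-2-h_{M-2})>P(2,M-2)$$ (with $h_{20}=10$), and consecutive chains are joined by the same strict inequality; the last term is $P(2,20)$. *(v)* The ordering continues, on at most $22$ cycle vertices, by $$\begin{aligned} &P(2,20)>P(10,10)>P(8,12)>N(2,16)>P(6,14)>P(4,16)>N(4,14)>N(6,12)\\ &>N(8,10)>P(2,18)>N(2,14)>P(8,10)>P(6,12)>P(4,14)>N(4,12)>N(6,10)\\ &>N(8,8)>P(2,16)>N(2,12)>P(8,8)>P(6,10)>P(4,12)>N(4,10)>N(6,8)\\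 &>P(2,14)>N(2,10)>P(6,8)>P(4,10)>N(4,8)>N(6,6)>P(2,12)>N(2,8)\\ &>P(6,6)>P(4,8)=N(4,6)>P(2,10)>N(2,6)>N(4,4)>P(4,6)\\ &>P(2,8)=N(2,4)>P(4,4)=N(2,2)>P(2,6)>P(2,4)>P(2,2). \end{aligned}$$ *The ordering is the whole one.* If $n\ge22$, then the pair of cycles of every $S\in\mathcal S_n$ whose two cycles have the same sign occurs (up to the order of the two cycles) as a term of the chain for $n$ in (i)–(iv) or of the chain in (v), and every term of these chains is realized by some $S\in\mathcal S_n$. If $4\le n\le 22$, the same holds with the chain of (iii) for $m=22$ together with the chain in (v), when only the terms $P(a,b),N(a,b)$ with $a+b\le n$ are kept. -/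

import Mathlib

open scoped BigOperators

/-- A signed digraph on the vertex set `V`: a set of arcs together with a sign for every arc.
`sign u v` is meaningful only when `Arc u v` holds; its other values are never used. -/
structure SignedDigraph (V : Type*) where
  Arc : V → V → Prop
  sign : V → V → ℤˣ

namespace SignedDigraph

variable {V : Type*}

open Classical in
/-- The adjacency matrix: the sign of `uv` at an arc `uv`, and `0` elsewhere. -/
noncomputable def adjMatrix (S : SignedDigraph V) : Matrix V V ℂ :=
  Matrix.of fun u v => if S.Arc u v then ((S.sign u v : ℤ) : ℂ) else 0

/-- The iota energy `∑ |Im z_k|` over the eigenvalues of the adjacency matrix, that is, over the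
complex roots of its characteristic polynomial counted with multiplicity. -/
noncomputable def iotaEnergy [Fintype V] [DecidableEq V] (S : SignedDigraph V) : ℝ :=
  (S.adjMatrix.charpoly.roots.map fun z => |z.im|).sum

/-- `c 0 → c 1 → ⋯ → c (r - 1) → c 0` is a directed cycle of `S` with `r ≥ 1` distinct vertices
(`r = 1` is a loop, `r = 2` is a pair of opposite arcs). -/
structure IsDirectedCycle (S : SignedDigraph V) {r : ℕ} (c : Fin r → V) : Prop where
  pos : 0 < r
  injective : Function.Injective c
  arc : ∀ i, S.Arc (c i) (c (finRotate r i))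

/-- The arc set of the cyclic sequence `c`. -/
def cycleArcs {r : ℕ} (c : Fin r → V) : Set (V × V) :=
  Set.range fun i => (c i, c (finRotate r i))

/-- The sign of the cycle `c`: the product of the signs of its arcs. -/
def cycleSign (S : SignedDigraph V) {r : ℕ} (c : Fin r → V) : ℤˣ :=
  ∏ i, S.sign (c i) (c (finRotate r i))

/-- The directed cycles of `S`, each given by its arc set. -/
def directedCycles (S : SignedDigraph V) : Set (Set (V × V)) :=
  {A | ∃ (r : ℕ) (c : Fin r → V), S.IsDirectedCycle c ∧ cycleArcs c = A}

/-- `S` is connected (its underlying graph is) and has exactly two directed cycles; these are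
vertex-disjoint, of even lengths `r₁` and `r₂`, and have the signs `ε₁` and `ε₂`. -/
def IsBicyclicEven (S : SignedDigraph V) (r₁ r₂ : ℕ) (ε₁ ε₂ : ℤˣ) : Prop :=
  (SimpleGraph.fromRel S.Arc).Connected ∧ Even r₁ ∧ Even r₂ ∧
    ∃ (c₁ : Fin r₁ → V) (c₂ : Fin r₂ → V),
      S.IsDirectedCycle c₁ ∧ S.IsDirectedCycle c₂ ∧
      Disjoint (Set.range c₁) (Set.range c₂) ∧
      S.directedCycles = {cycleArcs c₁, cycleArcs c₂} ∧
      S.cycleSign c₁ = ε₁ ∧ S.cycleSign c₂ = ε₂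

/-- The directed cycle `0 → 1 → ⋯ → r - 1 → 0`, where the arc that leaves `i` has sign `s i`. -/
def cycle {r : ℕ} (s : Fin r → ℤˣ) : SignedDigraph (Fin r) where
  Arc i j := j = finRotate r i
  sign i _ := s i

/-- `C_r^+` (for `ε = 1`) and `C_r^-` (for `ε = -1`): the directed cycle on `r` vertices whose
closing arc has sign `ε` and whose other arcs are positive. -/
def signedCycle (r : ℕ) (ε : ℤˣ) : SignedDigraph (Fin r) :=
  cycle fun i => if (i : ℕ) + 1 = r then ε else 1

end SignedDigraph

/-- Two directed cycles of the same sign: `pos a b` stands for `C_a^+, C_b^+` and `neg a b`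
for `C_a^-, C_b^-`. -/
inductive CyclePair where
  | pos (a b : ℕ) : CyclePair
  | neg (a b : ℕ) : CyclePair

namespace CyclePair

/-- The number of vertices on the two cycles. -/
def size : CyclePair → ℕ
  | pos a b => a + b
  | neg a b => a + b

/-- `E_c(C_a^+) + E_c(C_b^+)`, respectively `E_c(C_a^-) + E_c(C_b^-)`. -/
noncomputable def energy : CyclePair → ℝ
  | pos a b => (SignedDigraph.signedCycle a 1).iotaEnergy +
      (SignedDigraph.signedCycle b 1).iotaEnergy
  | neg a b => (SignedDigraph.signedCycle a (-1)).iotaEnergy +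
      (SignedDigraph.signedCycle b (-1)).iotaEnergy

/-- `S` is a bicyclic signed digraph whose two cycles are those of the pair. -/
def IsPairOf {V : Type*} (S : SignedDigraph V) : CyclePair → Prop
  | pos a b => S.IsBicyclicEven a b 1 1
  | neg a b => S.IsBicyclicEven a b (-1) (-1)

/-- For even `N`: the list `neg 4 (N-4), neg 6 (N-6), …`, up to the last `neg a (N-a)` with `a`
even and `a ≤ N/2`. It ends with `neg (N/2) (N/2)` if `N/2` is even and with
`neg (N/2-1) (N/2+1)` if `N/2` is odd. -/
def negDown (N : ℕ) : List CyclePair :=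
  (List.range (N / 4 - 1)).map fun i => neg (2 * i + 4) (N - (2 * i + 4))

/-- For even `N`: the list of the `pos a (N-a)` with `a` even and `6 ≤ a ≤ N/2`, from the largest
`a` (which is `N/2` or `N/2-1`) down to `pos 6 (N-6)`. -/
def posDown (N : ℕ) : List CyclePair :=
  ((List.range (N / 4 - 2)).map fun i => pos (2 * i + 6) (N - (2 * i + 6))).reverse

/-- For even `N ≥ 22`, the part of the chain
`posDown N, neg 2 (N-4), pos 4 (N-4), neg 4 (N-6), …, pos 2 (N-2)`. -/
def segment (N : ℕ) : List CyclePair :=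
  posDown N ++ [neg 2 (N - 4), pos 4 (N - 4)] ++ negDown (N - 2) ++ [pos 2 (N - 2)]

/-- For even `m ≥ 22`, the long chain: it starts with `neg 2 (m-2), neg 4 (m-4), …`,
continues with `segment m, segment (m-2), …, segment 22`, and so ends with `pos 2 20`. -/
def upperChain (m : ℕ) : List CyclePair :=
  neg 2 (m - 2) :: negDown m ++
    (List.range ((m - 22) / 2 + 1)).flatMap fun i => segment (m - 2 * i)

/-- The explicit chain that starts with `pos 2 20`; pairs of equal energy are put together into
one level. -/
def lowerChain : List (List CyclePair) :=
  [[pos 2 20], [pos 10 10], [pos 8 12], [neg 2 16],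
   [pos 6 14], [pos 4 16], [neg 4 14], [neg 6 12],
   [neg 8 10], [pos 2 18], [neg 2 14], [pos 8 10],
   [pos 6 12], [pos 4 14], [neg 4 12], [neg 6 10],
   [neg 8 8], [pos 2 16], [neg 2 12], [pos 8 8],
   [pos 6 10], [pos 4 12], [neg 4 10], [neg 6 8],
   [pos 2 14], [neg 2 10], [pos 6 8], [pos 4 10],
   [neg 4 8], [neg 6 6], [pos 2 12], [neg 2 8],
   [pos 6 6], [pos 4 8, neg 4 6], [pos 2 10],
   [neg 2 6], [neg 4 4], [pos 4 6], [pos 2 8, neg 2 4],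
   [pos 4 4, neg 2 2], [pos 2 6],
   [pos 2 4], [pos 2 2]]

/-- The pair occurs in the long chain for `m` or in the explicit chain. -/
def Listed (m : ℕ) (p : CyclePair) : Prop :=
  p ∈ upperChain m ∨ p ∈ lowerChain.flatten

end CyclePair

/-!
The eigenvalues of a signed digraph depend on its directed cycles only: in the Leibniz formula for
the characteristic polynomial, a permutation contributes only if it moves vertices along arcs, and
then all arcs that it uses lie on directed cycles (`SignedDigraph.exists_directedCycle_of_perm`).
So all arcs outside the two cycles may be deleted, the matrix becomes block diagonal, and the
energy is the sum of the energies of the two cycles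
(`SignedDigraph.iotaEnergy_of_isBicyclicEven`). The characteristic polynomial of a cycle of length
`r` and sign `ε` is `X ^ r - ε`, whose roots are equally spaced on the unit circle, and a telescoping
sum of sines gives the energies `2 cot (π / r)` and `2 csc (π / r)` for even `r`.

The ordering rests on these properties of the two functions for `x ≥ 2`: `csc (π / x)` is strictly
convex, so `N(a, M - a)` decreases as the lengths approach each other; `cot (π / x)` is strictly
concave, so `P(a, M - a)` increases; `cot (π / x)` is superadditive, so `P(a, b) < P(2, a + b)`,
where `P(2, c) = 2 cot (π / c)`; and `cot t < 1 / t < csc t`, so `N(a, b) > P(2, a + b)`. Only the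
passages `P(6, M - 6) > N(2, M - 4)` and `P(4, M - 4) > N(4, M - 6)` and the explicit chain need
numerical estimates. These come from truncated Laurent series of `cot` and `csc` at `0`, which turn
every comparison into a linear inequality in `π`, `1 / π`, `π ^ 3`, `√2` and `√3`.

Every pair of even lengths `a`, `b ≥ 2` with `a + b ≤ n` is realized by the directed path on `n`
vertices together with two backward arcs (`SignedDigraph.pathWithTwoCycles`); that these pairs are
the listed ones is a matter of sorting them by `a + b`.
-/

/-! ### The rotation of `Fin r` -/

namespace SignedDigraph

open Polynomial

theorem finRotate_val_of_lt {r : ℕ} {i : Fin r} (h : (i : ℕ) + 1 < r) :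
    (finRotate r i : ℕ) = i + 1 := by
  obtain ⟨r, rfl⟩ : ∃ k, r = k + 1 := ⟨r - 1, by omega⟩
  rw [coe_finRotate, if_neg]
  rintro rfl
  simp at h

theorem finRotate_val_of_eq {r : ℕ} {i : Fin r} (h : (i : ℕ) + 1 = r) :
    (finRotate r i : ℕ) = 0 := by
  obtain ⟨r, rfl⟩ : ∃ k, r = k + 1 := ⟨r - 1, by omega⟩
  rw [coe_finRotate, if_pos]
  ext
  simpa using h

theorem finRotate_ne_self {r : ℕ} (hr : 2 ≤ r) (i : Fin r) : finRotate r i ≠ i := by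
  intro h
  have := congrArg Fin.val h
  have hi := i.isLt
  rcases Nat.lt_or_ge ((i : ℕ) + 1) r with h' | h'
  · rw [finRotate_val_of_lt h'] at this; omega
  · rw [finRotate_val_of_eq (by omega)] at this; omega

/-- The rotation acts transitively: a property that it preserves holds everywhere or nowhere. -/
theorem finRotate_induction {r : ℕ} {p : Fin r → Prop} (h : ∀ i, p i → p (finRotate r i))
    {i : Fin r} (hi : p i) (j : Fin r) : p j := by
  rcases Nat.lt_or_ge r 2 with hr | hr
  · have : i = j := by ext; omega
    exact this ▸ hi
  · obtain ⟨k, -, rfl⟩ := ((isCycle_finRotate_of_le hr).sameCycle (finRotate_ne_self hr i)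
      (finRotate_ne_self hr j)).exists_pow_eq'
    clear * - h hi
    induction k with
    | zero => simpa using hi
    | succ k ih => rw [pow_succ', Equiv.Perm.mul_apply]; exact h _ ih

/-- The identity and the rotation are the only permutations that move every point by at most one
step of the rotation. -/
theorem eq_one_or_eq_finRotate {r : ℕ} {σ : Equiv.Perm (Fin r)}
    (h : ∀ i, σ i = i ∨ σ i = finRotate r i) : σ = 1 ∨ σ = finRotate r := by
  by_cases hfix : ∃ i, σ i ≠ i
  · obtain ⟨i, hi⟩ := hfix
    right
    have key : ∀ j, σ j ≠ j → σ (finRotate r j) ≠ finRotate r j := by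
      intro j hj hj'
      exact hj (σ.injective (((h j).resolve_left hj).trans hj'.symm) ▸ hj')
    ext1 j
    exact (h j).resolve_left (finRotate_induction key hi j)
  · left
    push Not at hfix
    ext1 j
    exact hfix j

/-! ### The energy of a signed directed cycle -/

theorem adjMatrix_cycle_apply {r : ℕ} (s : Fin r → ℤˣ) (i j : Fin r) :
    (cycle s).adjMatrix i j = if j = finRotate r i then ((s i : ℤ) : ℂ) else 0 := by
  simp only [adjMatrix, cycle, Matrix.of_apply]
  congr

/-- In the Leibniz formula only the identity and the rotation contribute. -/
theorem charpoly_cycle {r : ℕ} (hr : 2 ≤ r) (s : Fin r → ℤˣ) :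
    (cycle s).adjMatrix.charpoly = X ^ r - C (((∏ i, s i : ℤˣ) : ℤ) : ℂ) := by
  have hent : ∀ i j, (cycle s).adjMatrix.charmatrix i j =
      (if i = j then X else 0) - if j = finRotate r i then C (((s i : ℤˣ) : ℤ) : ℂ) else 0 := by
    intro i j
    rw [Matrix.charmatrix_apply, Matrix.diagonal_apply, adjMatrix_cycle_apply, apply_ite C, C_0]
  have hne : (1 : Equiv.Perm (Fin r)) ≠ finRotate r := fun h =>
    finRotate_ne_self hr ⟨0, by omega⟩ (by rw [← h]; rfl)
  rw [Matrix.charpoly, ← Matrix.det_transpose, Matrix.det_apply,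
    ← Finset.sum_subset (Finset.subset_univ {1, finRotate r}), Finset.sum_pair hne]
  · have hrot : ∀ i, i ≠ finRotate r i := fun i => (finRotate_ne_self hr i).symm
    simp only [Matrix.transpose_apply, hent, Equiv.Perm.sign_one, Equiv.Perm.one_apply, hrot,
      sign_finRotate, if_true, if_false, sub_zero, zero_sub, Finset.prod_const, Finset.card_univ,
      Fintype.card_fin, one_smul, Finset.prod_neg]
    obtain ⟨k, rfl⟩ : ∃ k, r = k + 1 := ⟨r - 1, by omega⟩
    rw [Units.smul_def, zsmul_eq_mul, sub_eq_add_neg]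
    congr 1
    push_cast
    rw [map_prod, ← mul_assoc, ← pow_add,
      show k + (k + 1) = 2 * k + 1 by ring, pow_succ, pow_mul]
    simp
  · intro σ _ hσ
    have : ∃ i, ¬(σ i = i ∨ σ i = finRotate r i) := by
      by_contra hc
      push Not at hc
      apply hσ
      simpa using eq_one_or_eq_finRotate hc
    obtain ⟨i, hi⟩ := this
    push Not at hi
    rw [Finset.prod_eq_zero (Finset.mem_univ i), smul_zero]
    rw [Matrix.transpose_apply, hent, if_neg hi.1.symm, if_neg hi.2, sub_zero]

/-- A sum of sines over half a turn in `m` equal steps; it telescopes once it is multiplied by the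
sine of half a step. -/
theorem sum_sin_half_turn {m : ℕ} (hm : 0 < m) (θ : ℝ) :
    (∑ k ∈ Finset.range m, Real.sin (θ + k * (Real.pi / m))) * Real.sin (Real.pi / (2 * m)) =
      Real.cos (θ - Real.pi / (2 * m)) := by
  have hm' : (m : ℝ) ≠ 0 := by positivity
  set δ := Real.pi / (2 * m) with hδ
  have h2 : Real.pi / m = 2 * δ := by rw [hδ]; field_simp
  have step : ∀ k : ℕ, Real.sin (θ + k * (Real.pi / m)) * Real.sin δ =
      -Real.cos (θ + (2 * (k + 1 : ℕ) - 1) * δ) / 2 - -Real.cos (θ + (2 * k - 1) * δ) / 2 := by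
    intro k
    have e1 : θ + (2 * ((k + 1 : ℕ) : ℝ) - 1) * δ = (θ + k * (Real.pi / m)) + δ := by
      rw [h2]; push_cast; ring
    have e2 : θ + (2 * (k : ℝ) - 1) * δ = (θ + k * (Real.pi / m)) - δ := by rw [h2]; ring
    rw [e1, e2, Real.cos_add, Real.cos_sub]
    ring
  rw [Finset.sum_mul, Finset.sum_congr rfl fun k _ => step k,
    Finset.sum_range_sub (fun k : ℕ => -Real.cos (θ + (2 * k - 1) * δ) / 2)]
  have e1 : θ + (2 * (m : ℝ) - 1) * δ = (θ - δ) + Real.pi := by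
    rw [hδ]; field_simp; ring
  have e2 : θ + (2 * ((0 : ℕ) : ℝ) - 1) * δ = θ - δ := by push_cast; ring
  rw [e1, e2, Real.cos_add_pi]
  ring

/-- The sum of `|Im z|` over the roots of `X ^ (2 * m) - a`, where some root has argument `θ`
and `θ` is at most the step `π / m` between consecutive roots. -/
theorem sum_abs_im_roots {m : ℕ} (hm : 0 < m) {θ : ℝ} (h0 : 0 ≤ θ) (h1 : θ ≤ Real.pi / m) {a : ℂ}
    (ha : Complex.exp (θ * Complex.I) ^ (2 * m) = a) :
    ((X ^ (2 * m) - C a : ℂ[X]).roots.map fun z => |z.im|).sum =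
      2 * (Real.cos (θ - Real.pi / (2 * m)) / Real.sin (Real.pi / (2 * m))) := by
  have hm' : (m : ℝ) ≠ 0 := by positivity
  have hpi := Real.pi_pos
  have hζ := Complex.isPrimitiveRoot_exp (2 * m) (by omega)
  have hroots : (X ^ (2 * m) - C a : ℂ[X]).roots = nthRoots (2 * m) a := rfl
  have him : ∀ k : ℕ, (Complex.exp (2 * Real.pi * Complex.I / (2 * m : ℕ)) ^ k *
      Complex.exp (θ * Complex.I)).im = Real.sin (θ + k * (Real.pi / m)) := by
    intro k
    rw [← Complex.exp_nat_mul, ← Complex.exp_add]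
    have : (k : ℂ) * (2 * Real.pi * Complex.I / (2 * m : ℕ)) + θ * Complex.I =
        ((θ + k * (Real.pi / m) : ℝ) : ℂ) * Complex.I := by
      have : (m : ℂ) ≠ 0 := by exact_mod_cast hm.ne'
      push_cast
      field_simp
      ring
    rw [this, Complex.exp_ofReal_mul_I_im]
  rw [hroots, hζ.nthRoots_eq ha, Multiset.map_map]
  change ∑ k ∈ Finset.range (2 * m), _ = _
  simp only [Function.comp, him]
  have hnn : ∀ k ∈ Finset.range m, |Real.sin (θ + k * (Real.pi / m))| =
      Real.sin (θ + k * (Real.pi / m)) := by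
    intro k hk
    have hk' : (k : ℝ) + 1 ≤ m := by exact_mod_cast Finset.mem_range.mp hk
    apply abs_of_nonneg
    apply Real.sin_nonneg_of_nonneg_of_le_pi
    · positivity
    · calc θ + k * (Real.pi / m) ≤ Real.pi / m + k * (Real.pi / m) := by linarith
        _ = (k + 1) * (Real.pi / m) := by ring
        _ ≤ m * (Real.pi / m) := by gcongr
        _ = Real.pi := by field_simp
  have hsin : 0 < Real.sin (Real.pi / (2 * m)) := by
    apply Real.sin_pos_of_pos_of_lt_pi (by positivity)
    apply div_lt_self hpi
    have : (1 : ℝ) ≤ m := by exact_mod_cast hm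
    linarith
  have hper : ∀ k : ℕ, Real.sin (θ + (m + k : ℕ) * (Real.pi / m)) =
      -Real.sin (θ + k * (Real.pi / m)) := by
    intro k
    rw [← Real.sin_add_pi]
    congr 1
    push_cast
    field_simp
    ring
  -- The second half of the roots is the first half multiplied by `-1`.
  rw [two_mul m, Finset.sum_range_add]
  simp only [hper, abs_neg]
  rw [Finset.sum_congr rfl hnn, ← two_mul, ← sum_sin_half_turn hm, mul_div_cancel_right₀ _ hsin.ne']

theorem iotaEnergy_cycle {r : ℕ} (hr : 2 ≤ r) (s : Fin r → ℤˣ) :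
    (cycle s).iotaEnergy =
      ((X ^ r - C (((∏ i, s i : ℤˣ) : ℤ) : ℂ) : ℂ[X]).roots.map fun z => |z.im|).sum := by
  rw [iotaEnergy, charpoly_cycle hr]

theorem prod_signedCycle {r : ℕ} (hr : 0 < r) (ε : ℤˣ) :
    ∏ i : Fin r, (if (i : ℕ) + 1 = r then ε else 1) = ε := by
  rw [Finset.prod_eq_single ⟨r - 1, by omega⟩]
  · simp; omega
  · intro i _ hi
    rw [if_neg]
    intro h
    exact hi (Fin.ext (by simp; omega))
  · simp

theorem iotaEnergy_cycle_eq_signedCycle {r : ℕ} (hr : 2 ≤ r) (s : Fin r → ℤˣ) :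
    (cycle s).iotaEnergy = (signedCycle r (∏ i, s i)).iotaEnergy := by
  rw [signedCycle, iotaEnergy_cycle hr, iotaEnergy_cycle hr, prod_signedCycle (by omega)]

theorem iotaEnergy_signedCycle_one {r : ℕ} (hr : 2 ≤ r) (he : Even r) :
    (signedCycle r 1).iotaEnergy = 2 * Real.cot (Real.pi / r) := by
  obtain ⟨m, rfl⟩ := he.two_dvd
  have hm : 0 < m := by omega
  rw [signedCycle, iotaEnergy_cycle hr, prod_signedCycle (by omega),
    sum_abs_im_roots hm (θ := 0) le_rfl (by positivity) (by simp), Real.cot_eq_cos_div_sin]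
  simp

theorem iotaEnergy_signedCycle_neg_one {r : ℕ} (hr : 2 ≤ r) (he : Even r) :
    (signedCycle r (-1)).iotaEnergy = 2 * (Real.sin (Real.pi / r))⁻¹ := by
  obtain ⟨m, rfl⟩ := he.two_dvd
  have hm : 0 < m := by omega
  have hm' : (m : ℂ) ≠ 0 := by exact_mod_cast hm.ne'
  have hpi := Real.pi_pos
  rw [signedCycle, iotaEnergy_cycle hr, prod_signedCycle (by omega),
    sum_abs_im_roots hm (θ := Real.pi / (2 * m)) (by positivity)]
  · simp
  · gcongr
    have : (0 : ℝ) ≤ m := by positivity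
    linarith
  · rw [← Complex.exp_nat_mul]
    have : ((2 * m : ℕ) : ℂ) * (((Real.pi / (2 * m) : ℝ) : ℂ) * Complex.I) =
        Real.pi * Complex.I := by
      push_cast
      field_simp
    rw [this, Complex.exp_pi_mul_I]
    simp

end SignedDigraph

/-! ### Removing the arcs that lie on no directed cycle -/

namespace SignedDigraph

open Polynomial

variable {V : Type*}

/-- If `B` arises from `A` by deleting entries, and no deleted entry lies on a permutation whose
moved points all give nonzero entries of `A`, then the Leibniz formulas of the two characteristic
polynomials agree term by term. -/
theorem charpoly_eq_of_forall_perm [Fintype V] [DecidableEq V] {A B : Matrix V V ℂ}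
    (hoff : ∀ x y, B x y = A x y ∨ B x y = 0)
    (h : ∀ σ : Equiv.Perm V, (∀ x, σ x ≠ x → A x (σ x) ≠ 0) → ∀ x, B x (σ x) = A x (σ x)) :
    A.charpoly = B.charpoly := by
  rw [Matrix.charpoly, Matrix.charpoly, ← Matrix.det_transpose A.charmatrix,
    ← Matrix.det_transpose B.charmatrix, Matrix.det_apply, Matrix.det_apply]
  refine Finset.sum_congr rfl fun σ _ => ?_
  congr 1
  by_cases hσ : ∀ x, σ x ≠ x → A x (σ x) ≠ 0
  · refine Finset.prod_congr rfl fun x _ => ?_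
    rw [Matrix.transpose_apply, Matrix.transpose_apply, Matrix.charmatrix_apply,
      Matrix.charmatrix_apply, h σ hσ]
  · push Not at hσ
    obtain ⟨x, hx, hA⟩ := hσ
    have hB : B x (σ x) = 0 := by rcases hoff x (σ x) with h | h <;> simp [h, hA]
    rw [Finset.prod_eq_zero (Finset.mem_univ x), Finset.prod_eq_zero (Finset.mem_univ x)]
    · rw [Matrix.transpose_apply, Matrix.charmatrix_apply_ne _ _ _ hx.symm, hB]; simp
    · rw [Matrix.transpose_apply, Matrix.charmatrix_apply_ne _ _ _ hx.symm, hA]; simp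

/-- A permutation that moves vertices along arcs only runs around directed cycles. -/
theorem exists_directedCycle_of_perm [Finite V] {S : SignedDigraph V} {σ : Equiv.Perm V}
    (hσ : ∀ x, σ x ≠ x → S.Arc x (σ x)) {x : V} (hx : σ x ≠ x) :
    ∃ A ∈ S.directedCycles, (x, σ x) ∈ A := by
  set r := Function.minimalPeriod σ x with hr
  have hpos : 0 < r := Function.minimalPeriod_pos_of_mem_periodicPts
    (Function.Injective.mem_periodicPts σ.injective x)
  let c : Fin r → V := fun i => σ^[i] x
  have hsucc : ∀ i, c (finRotate r i) = σ (c i) := by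
    intro i
    have hi := i.isLt
    change σ^[(finRotate r i : ℕ)] x = σ (σ^[(i : ℕ)] x)
    rw [← Function.iterate_succ_apply' σ]
    rcases Nat.lt_or_ge ((i : ℕ) + 1) r with h | h
    · rw [finRotate_val_of_lt h]
    · have h' : (i : ℕ) + 1 = r := by omega
      rw [finRotate_val_of_eq h', Nat.succ_eq_add_one, h', hr, Function.iterate_minimalPeriod]
      rfl
  have hmoved : ∀ k : ℕ, σ (σ^[k] x) ≠ σ^[k] x := by
    intro k
    induction k with
    | zero => exact hx
    | succ k ih =>
      rw [Function.iterate_succ_apply']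
      exact fun h => ih (σ.injective h)
  refine ⟨cycleArcs c, ⟨r, c, ⟨hpos, ?_, ?_⟩, rfl⟩, ⟨⟨0, hpos⟩, ?_⟩⟩
  · intro i j hij
    exact Fin.ext (Function.iterate_injOn_Iio_minimalPeriod i.isLt j.isLt hij)
  · intro i
    rw [hsucc]
    exact hσ _ (hmoved i)
  · simp only [hsucc]
    rfl

theorem mem_cycleArcs_iff {r : ℕ} {c : Fin r → V} (hc : Function.Injective c) (i j : Fin r) :
    (c i, c j) ∈ cycleArcs c ↔ j = finRotate r i := by
  constructor
  · rintro ⟨k, hk⟩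
    rw [Prod.mk.injEq] at hk
    rw [← hc hk.1, hc hk.2]
  · rintro rfl
    exact ⟨i, rfl⟩

theorem fst_mem_range_of_mem_cycleArcs {r : ℕ} {c : Fin r → V} {x y : V}
    (h : (x, y) ∈ cycleArcs c) : x ∈ Set.range c := by
  obtain ⟨k, hk⟩ := h
  exact ⟨k, congrArg Prod.fst hk⟩

theorem snd_mem_range_of_mem_cycleArcs {r : ℕ} {c : Fin r → V} {x y : V}
    (h : (x, y) ∈ cycleArcs c) : y ∈ Set.range c := by
  obtain ⟨k, hk⟩ := h
  exact ⟨_, congrArg Prod.snd hk⟩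

/-- A loop would be a directed cycle, with one arc. -/
theorem not_arc_self {S : SignedDigraph V} {a b : ℕ} {c₁ : Fin a → V} {c₂ : Fin b → V}
    (ha : 2 ≤ a) (hb : 2 ≤ b) (h₁ : Function.Injective c₁) (h₂ : Function.Injective c₂)
    (h : S.directedCycles = {cycleArcs c₁, cycleArcs c₂}) (x : V) : ¬S.Arc x x := by
  intro hx
  have hmem : cycleArcs (fun _ : Fin 1 => x) ∈ S.directedCycles :=
    ⟨1, fun _ => x, ⟨one_pos, fun i j _ => Subsingleton.elim i j, fun _ => hx⟩, rfl⟩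
  have hxx : (x, x) ∈ cycleArcs (fun _ : Fin 1 => x) := ⟨0, rfl⟩
  have key : ∀ {r : ℕ} {c : Fin r → V}, 2 ≤ r → Function.Injective c → (x, x) ∉ cycleArcs c := by
    rintro r c hr hc ⟨k, hk⟩
    rw [Prod.mk.injEq] at hk
    exact finRotate_ne_self hr k (hc (hk.2.trans hk.1.symm))
  rw [h] at hmem
  rcases hmem with hm | hm <;> rw [hm] at hxx
  exacts [key ha h₁ hxx, key hb h₂ hxx]

theorem two_le_of_even_cycle {S : SignedDigraph V} {r : ℕ} {c : Fin r → V}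
    (hc : S.IsDirectedCycle c) (he : Even r) : 2 ≤ r := by
  have := hc.pos
  obtain ⟨k, rfl⟩ := he
  omega

open Classical in
/-- The characteristic polynomial sees the directed cycles only: the arcs on no cycle can be
dropped, and what remains is the disjoint union of two cycles and some isolated vertices. -/
theorem charpoly_of_two_cycles [Fintype V] [DecidableEq V] {S : SignedDigraph V} {a b : ℕ}
    {c₁ : Fin a → V} {c₂ : Fin b → V} (ha : 2 ≤ a) (hb : 2 ≤ b) (h₁ : S.IsDirectedCycle c₁)
    (h₂ : S.IsDirectedCycle c₂) (hdisj : Disjoint (Set.range c₁) (Set.range c₂))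
    (h : S.directedCycles = {cycleArcs c₁, cycleArcs c₂}) :
    ∃ k, S.adjMatrix.charpoly =
      (cycle fun i => S.sign (c₁ i) (c₁ (finRotate a i))).adjMatrix.charpoly *
      (cycle fun i => S.sign (c₂ i) (c₂ (finRotate b i))).adjMatrix.charpoly * X ^ k := by
  have hloop := not_arc_self ha hb h₁.injective h₂.injective h
  set B : Matrix V V ℂ := Matrix.of fun x y =>
    if (x, y) ∈ cycleArcs c₁ ∪ cycleArcs c₂ then S.adjMatrix x y else 0 with hB
  have hAB : S.adjMatrix.charpoly = B.charpoly := by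
    apply charpoly_eq_of_forall_perm
    · intro x y
      simp only [hB, Matrix.of_apply]
      split_ifs <;> simp
    · intro σ hσ x
      by_cases hx : σ x = x
      · rw [hx]
        simp [hB, adjMatrix, hloop]
      · obtain ⟨A, hA, hxA⟩ := exists_directedCycle_of_perm (S := S) (σ := σ) (by
          intro y hy
          by_contra hn
          exact hσ y hy (by simp [adjMatrix, hn])) hx
        rw [h] at hA
        have : (x, σ x) ∈ cycleArcs c₁ ∪ cycleArcs c₂ := by
          rcases hA with hA | hA <;> rw [hA] at hxA
          exacts [Or.inl hxA, Or.inr hxA]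
        simp only [hB, Matrix.of_apply, if_pos this]
  have hcross₁ : ∀ i j, c₁ i ≠ c₂ j := fun i j he =>
    Set.disjoint_left.mp hdisj ⟨i, rfl⟩ ⟨j, he.symm⟩
  have hf : Function.Injective (Sum.elim c₁ c₂) := h₁.injective.sumElim h₂.injective hcross₁
  let e : (Fin a ⊕ Fin b) ⊕ ↥(Set.range (Sum.elim c₁ c₂))ᶜ ≃ V :=
    ((Equiv.ofInjective _ hf).sumCongr (Equiv.refl _)).trans (Equiv.Set.sumCompl _)
  have el : ∀ i, e (Sum.inl i) = Sum.elim c₁ c₂ i := fun i => rfl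
  have er : ∀ i, e (Sum.inr i) = i := fun i => rfl
  refine ⟨Fintype.card ↥(Set.range (Sum.elim c₁ c₂))ᶜ, ?_⟩
  -- Ordered as first cycle, second cycle, other vertices, the matrix `B` is block diagonal.
  have hblock : Matrix.reindex e.symm e.symm B = Matrix.fromBlocks (Matrix.fromBlocks
      (cycle fun i => S.sign (c₁ i) (c₁ (finRotate a i))).adjMatrix 0 0
      (cycle fun i => S.sign (c₂ i) (c₂ (finRotate b i))).adjMatrix) 0 0 0 := by
    have hmem : ∀ {x y : V}, (x, y) ∈ cycleArcs c₁ ∪ cycleArcs c₂ →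
        x ∈ Set.range (Sum.elim c₁ c₂) ∧ y ∈ Set.range (Sum.elim c₁ c₂) := by
      intro x y hxy
      rw [Set.Sum.elim_range]
      rcases hxy with hxy | hxy
      · exact ⟨Or.inl (fst_mem_range_of_mem_cycleArcs hxy),
          Or.inl (snd_mem_range_of_mem_cycleArcs hxy)⟩
      · exact ⟨Or.inr (fst_mem_range_of_mem_cycleArcs hxy),
          Or.inr (snd_mem_range_of_mem_cycleArcs hxy)⟩
    have n12 : ∀ i j, (c₁ i, c₂ j) ∉ cycleArcs c₁ ∪ cycleArcs c₂ := by
      rintro i j (hij | hij)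
      · exact Set.disjoint_left.mp hdisj (snd_mem_range_of_mem_cycleArcs hij) ⟨j, rfl⟩
      · exact Set.disjoint_left.mp hdisj ⟨i, rfl⟩ (fst_mem_range_of_mem_cycleArcs hij)
    have n21 : ∀ i j, (c₂ i, c₁ j) ∉ cycleArcs c₁ ∪ cycleArcs c₂ := by
      rintro i j (hij | hij)
      · exact Set.disjoint_left.mp hdisj (fst_mem_range_of_mem_cycleArcs hij) ⟨i, rfl⟩
      · exact Set.disjoint_left.mp hdisj ⟨j, rfl⟩ (snd_mem_range_of_mem_cycleArcs hij)
    have n11 : ∀ i j, (c₁ i, c₁ j) ∈ cycleArcs c₁ ∪ cycleArcs c₂ ↔ j = finRotate a i := by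
      intro i j
      rw [Set.mem_union, mem_cycleArcs_iff h₁.injective, or_iff_left]
      exact fun hij => Set.disjoint_left.mp hdisj ⟨i, rfl⟩ (fst_mem_range_of_mem_cycleArcs hij)
    have n22 : ∀ i j, (c₂ i, c₂ j) ∈ cycleArcs c₁ ∪ cycleArcs c₂ ↔ j = finRotate b i := by
      intro i j
      rw [Set.mem_union, mem_cycleArcs_iff h₂.injective, or_iff_right]
      exact fun hij => Set.disjoint_left.mp hdisj (fst_mem_range_of_mem_cycleArcs hij) ⟨i, rfl⟩
    ext x y
    rw [Matrix.reindex_apply, Matrix.submatrix_apply, Equiv.symm_symm, hB, Matrix.of_apply]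
    rcases x with (i | i) | i <;> rcases y with (j | j) | j <;> simp only [el, er, Sum.elim_inl,
      Sum.elim_inr, Matrix.fromBlocks_apply₁₁, Matrix.fromBlocks_apply₁₂,
      Matrix.fromBlocks_apply₂₁, Matrix.fromBlocks_apply₂₂, Matrix.zero_apply]
    · simp only [n11, adjMatrix_cycle_apply]
      split_ifs with hj
      · rw [adjMatrix, Matrix.of_apply, if_pos (hj ▸ h₁.arc i), hj]
      · rfl
    · rw [if_neg (n12 i j)]
    · exact if_neg fun hm => j.2 (hmem hm).2
    · rw [if_neg (n21 i j)]
    · simp only [n22, adjMatrix_cycle_apply]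
      split_ifs with hj
      · rw [adjMatrix, Matrix.of_apply, if_pos (hj ▸ h₂.arc i), hj]
      · rfl
    · exact if_neg fun hm => j.2 (hmem hm).2
    · exact if_neg fun hm => i.2 (hmem hm).1
    · exact if_neg fun hm => i.2 (hmem hm).1
    · exact if_neg fun hm => i.2 (hmem hm).1
  rw [hAB, ← Matrix.charpoly_reindex e.symm, hblock, Matrix.charpoly_fromBlocks_zero₁₂,
    Matrix.charpoly_fromBlocks_zero₁₂, Matrix.charpoly_zero]

/-- The vertices outside the two cycles contribute eigenvalues `0` only. -/
theorem iotaEnergy_of_isBicyclicEven [Fintype V] [DecidableEq V] {S : SignedDigraph V} {a b : ℕ}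
    {ε₁ ε₂ : ℤˣ} (h : S.IsBicyclicEven a b ε₁ ε₂) :
    S.iotaEnergy = (signedCycle a ε₁).iotaEnergy + (signedCycle b ε₂).iotaEnergy := by
  obtain ⟨-, ha, hb, c₁, c₂, h₁, h₂, hdisj, hcyc, rfl, rfl⟩ := h
  have ha' := two_le_of_even_cycle h₁ ha
  have hb' := two_le_of_even_cycle h₂ hb
  obtain ⟨k, hk⟩ := charpoly_of_two_cycles ha' hb' h₁ h₂ hdisj hcyc
  rw [cycleSign, cycleSign, ← iotaEnergy_cycle_eq_signedCycle ha',
    ← iotaEnergy_cycle_eq_signedCycle hb', iotaEnergy, hk, iotaEnergy, iotaEnergy,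
    roots_mul (mul_ne_zero (mul_ne_zero (Matrix.charpoly_monic _).ne_zero
      (Matrix.charpoly_monic _).ne_zero) (pow_ne_zero _ X_ne_zero)),
    roots_mul (mul_ne_zero (Matrix.charpoly_monic _).ne_zero (Matrix.charpoly_monic _).ne_zero),
    Multiset.map_add, Multiset.map_add, Multiset.sum_add, Multiset.sum_add, roots_X_pow,
    Multiset.map_nsmul, Multiset.sum_nsmul]
  simp

end SignedDigraph

/-! ### Taylor bounds for sine and cosine, Laurent bounds for cotangent and cosecant -/

section Trigonometry

open Real

theorem nonneg_of_hasDerivAt_nonneg {f f' : ℝ → ℝ} (hf : ∀ x, HasDerivAt f (f' x) x)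
    (h' : ∀ x, 0 ≤ x → 0 ≤ f' x) (h0 : f 0 = 0) {x : ℝ} (hx : 0 ≤ x) : 0 ≤ f x := by
  have hmono : MonotoneOn f (Set.Ici 0) := by
    apply monotoneOn_of_deriv_nonneg (convex_Ici 0)
    · exact fun y _ => (hf y).continuousAt.continuousWithinAt
    · exact fun y _ => (hf y).differentiableAt.differentiableWithinAt
    · intro y hy
      rw [interior_Ici] at hy
      rw [(hf y).deriv]
      exact h' y (le_of_lt hy)
  simpa [h0] using hmono Set.self_mem_Ici hx hx

theorem sin_ge_taylor_three {x : ℝ} (hx : 0 ≤ x) : x - x ^ 3 / 6 ≤ sin x := by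
  have := nonneg_of_hasDerivAt_nonneg (f := fun x => sin x - (x - x ^ 3 / 6))
    (f' := fun x => cos x - (1 - (3 * x ^ 2) / 6))
    (fun x => ((hasDerivAt_sin x).sub
      ((hasDerivAt_id x).sub ((hasDerivAt_pow 3 x).div_const 6))).congr_deriv (by simp))
    (fun x _ => by linarith [one_sub_sq_div_two_le_cos (x := x)]) (by simp) hx
  linarith

theorem cos_le_taylor_four {x : ℝ} (hx : 0 ≤ x) : cos x ≤ 1 - x ^ 2 / 2 + x ^ 4 / 24 := by
  have := nonneg_of_hasDerivAt_nonneg (f := fun x => 1 - x ^ 2 / 2 + x ^ 4 / 24 - cos x)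
    (f' := fun x => -((2 * x) / 2) + (4 * x ^ 3) / 24 + sin x)
    (fun x => (((((hasDerivAt_pow 2 x).div_const 2).const_sub 1).add
      ((hasDerivAt_pow 4 x).div_const 24)).sub (hasDerivAt_cos x)).congr_deriv (by simp))
    (fun x hx => by linarith [sin_ge_taylor_three hx]) (by simp) hx
  linarith

theorem sin_le_taylor_five {x : ℝ} (hx : 0 ≤ x) : sin x ≤ x - x ^ 3 / 6 + x ^ 5 / 120 := by
  have := nonneg_of_hasDerivAt_nonneg (f := fun x => x - x ^ 3 / 6 + x ^ 5 / 120 - sin x)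
    (f' := fun x => 1 - (3 * x ^ 2) / 6 + (5 * x ^ 4) / 120 - cos x)
    (fun x => ((((hasDerivAt_id x).sub ((hasDerivAt_pow 3 x).div_const 6)).add
      ((hasDerivAt_pow 5 x).div_const 120)).sub (hasDerivAt_sin x)).congr_deriv (by simp))
    (fun x hx => by linarith [cos_le_taylor_four hx]) (by simp) hx
  linarith

theorem cos_ge_taylor_six {x : ℝ} (hx : 0 ≤ x) :
    1 - x ^ 2 / 2 + x ^ 4 / 24 - x ^ 6 / 720 ≤ cos x := by
  have := nonneg_of_hasDerivAt_nonneg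
    (f := fun x => cos x - (1 - x ^ 2 / 2 + x ^ 4 / 24 - x ^ 6 / 720))
    (f' := fun x => -sin x - (-((2 * x) / 2) + (4 * x ^ 3) / 24 - (6 * x ^ 5) / 720))
    (fun x => ((hasDerivAt_cos x).sub (((((hasDerivAt_pow 2 x).div_const 2).const_sub
      1).add ((hasDerivAt_pow 4 x).div_const 24)).sub ((hasDerivAt_pow 6 x).div_const 720))).congr_deriv (by simp))
    (fun x hx => by linarith [sin_le_taylor_five hx]) (by simp) hx
  linarith

theorem sin_ge_taylor_seven {x : ℝ} (hx : 0 ≤ x) :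
    x - x ^ 3 / 6 + x ^ 5 / 120 - x ^ 7 / 5040 ≤ sin x := by
  have := nonneg_of_hasDerivAt_nonneg
    (f := fun x => sin x - (x - x ^ 3 / 6 + x ^ 5 / 120 - x ^ 7 / 5040))
    (f' := fun x => cos x - (1 - (3 * x ^ 2) / 6 + (5 * x ^ 4) / 120 - (7 * x ^ 6) / 5040))
    (fun x => ((hasDerivAt_sin x).sub ((((hasDerivAt_id x).sub
      ((hasDerivAt_pow 3 x).div_const 6)).add ((hasDerivAt_pow 5 x).div_const 120)).sub
      ((hasDerivAt_pow 7 x).div_const 5040))).congr_deriv (by simp))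
    (fun x hx => by linarith [cos_ge_taylor_six hx]) (by simp) hx
  linarith

theorem cot_le_laurent {x : ℝ} (h0 : 0 < x) (h1 : x ≤ 1) : cot x ≤ 1 / x - x / 3 := by
  have hs : 0 < sin x := sin_pos_of_pos_of_lt_pi h0 (by linarith [pi_gt_three])
  rw [cot_eq_cos_div_sin, div_le_iff₀ hs]
  have hx2 : x ^ 2 ≤ 1 := by nlinarith
  have e : 1 / x - x / 3 = (1 - x ^ 2 / 3) / x := by field_simp
  have hnn : 0 ≤ (1 - x ^ 2 / 3) / x := div_nonneg (by linarith) h0.le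
  calc cos x ≤ 1 - x ^ 2 / 2 + x ^ 4 / 24 := cos_le_taylor_four h0.le
    _ ≤ (1 - x ^ 2 / 3) * (1 - x ^ 2 / 6) := by nlinarith [pow_pos h0 4]
    _ = (1 - x ^ 2 / 3) / x * (x - x ^ 3 / 6) := by field_simp
    _ ≤ _ := by rw [e]; exact mul_le_mul_of_nonneg_left (sin_ge_taylor_three h0.le) hnn

/-- The coefficient of `x ^ 3` in the Laurent series of `cot` is `-1 / 45`; the larger `1 / 40` also
covers the tail of the series on `(0, 1]`. -/
theorem laurent_le_cot {x : ℝ} (h0 : 0 < x) (h1 : x ≤ 1) :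
    1 / x - x / 3 - x ^ 3 / 40 ≤ cot x := by
  have hs : 0 < sin x := sin_pos_of_pos_of_lt_pi h0 (by linarith [pi_gt_three])
  rw [cot_eq_cos_div_sin, le_div_iff₀ hs]
  have hx2 : x ^ 2 ≤ 1 := by nlinarith
  have hx4 : 0 < x ^ 4 := by positivity
  have hx4' : x ^ 4 ≤ 1 := by nlinarith
  have e : 1 / x - x / 3 - x ^ 3 / 40 = (1 - x ^ 2 / 3 - x ^ 4 / 40) / x := by field_simp
  have hnn : 0 ≤ (1 - x ^ 2 / 3 - x ^ 4 / 40) / x := div_nonneg (by linarith) h0.le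
  calc (1 / x - x / 3 - x ^ 3 / 40) * sin x
      ≤ (1 - x ^ 2 / 3 - x ^ 4 / 40) / x * (x - x ^ 3 / 6 + x ^ 5 / 120) := by
        rw [e]; exact mul_le_mul_of_nonneg_left (sin_le_taylor_five h0.le) hnn
    _ = (1 - x ^ 2 / 3 - x ^ 4 / 40) * (1 - x ^ 2 / 6 + x ^ 4 / 120) := by field_simp
    _ ≤ 1 - x ^ 2 / 2 + x ^ 4 / 24 - x ^ 6 / 720 := by
        nlinarith [mul_le_mul_of_nonneg_left hx2 hx4.le, mul_le_mul_of_nonneg_left hx4' hx4.le,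
          mul_nonneg hx4.le hx4.le]
    _ ≤ cos x := cos_ge_taylor_six h0.le

theorem laurent_le_csc {x : ℝ} (h0 : 0 < x) (h1 : x ≤ 1) : 1 / x + x / 6 ≤ (sin x)⁻¹ := by
  have hs : 0 < sin x := sin_pos_of_pos_of_lt_pi h0 (by linarith [pi_gt_three])
  rw [← one_div, le_div_iff₀ hs]
  have hx2 : x ^ 2 ≤ 1 := by nlinarith
  have hx4 : 0 < x ^ 4 := by positivity
  calc (1 / x + x / 6) * sin x ≤ (1 / x + x / 6) * (x - x ^ 3 / 6 + x ^ 5 / 120) :=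
        mul_le_mul_of_nonneg_left (sin_le_taylor_five h0.le) (by positivity)
    _ = (1 + x ^ 2 / 6) * (1 - x ^ 2 / 6 + x ^ 4 / 120) := by field_simp
    _ ≤ 1 := by nlinarith [mul_le_mul_of_nonneg_left hx2 hx4.le]

/-- The coefficient of `x ^ 3` in the Laurent series of the cosecant is `7 / 360`; the larger
`1 / 45` also covers the tail of the series on `(0, 1]`. -/
theorem csc_le_laurent {x : ℝ} (h0 : 0 < x) (h1 : x ≤ 1) :
    (sin x)⁻¹ ≤ 1 / x + x / 6 + x ^ 3 / 45 := by
  have hs : 0 < sin x := sin_pos_of_pos_of_lt_pi h0 (by linarith [pi_gt_three])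
  rw [← one_div, div_le_iff₀ hs]
  have hx2 : x ^ 2 ≤ 1 := by nlinarith
  have hx4 : 0 < x ^ 4 := by positivity
  have hx6 : x ^ 6 ≤ x ^ 4 := by nlinarith
  have hx8 : x ^ 8 ≤ x ^ 4 := by nlinarith [mul_le_mul_of_nonneg_left hx2 (pow_pos h0 6).le]
  have hx10 : x ^ 10 ≤ x ^ 4 := by nlinarith [mul_le_mul_of_nonneg_left hx2 (pow_pos h0 8).le]
  calc (1 : ℝ) ≤ (1 + x ^ 2 / 6 + x ^ 4 / 45) * (1 - x ^ 2 / 6 + x ^ 4 / 120 - x ^ 6 / 5040) := by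
        have : 0 < x ^ 6 := by positivity
        have : 0 < x ^ 8 := by positivity
        nlinarith
    _ = (1 / x + x / 6 + x ^ 3 / 45) * (x - x ^ 3 / 6 + x ^ 5 / 120 - x ^ 7 / 5040) := by
        field_simp
    _ ≤ _ := mul_le_mul_of_nonneg_left (sin_ge_taylor_seven h0.le) (by positivity)

/-! ### Convexity of `csc (π / x)`, concavity and superadditivity of `cot (π / x)` -/

theorem hasDerivAt_pi_div {x : ℝ} (hx : x ≠ 0) :
    HasDerivAt (fun x => π / x) (-(π / x) ^ 2 / π) x := by
  have h := (hasDerivAt_inv hx).const_mul π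
  simp only [← div_eq_mul_inv] at h
  refine h.congr_deriv ?_
  have := pi_pos.ne'
  field_simp

theorem pi_div_mem {x : ℝ} (hx : 2 < x) : 0 < π / x ∧ π / x < π / 2 := by
  have := pi_pos
  exact ⟨by positivity, by gcongr⟩

theorem pi_div_pos_lt {x : ℝ} (hx : 2 ≤ x) : 0 < π / x ∧ π / x < π := by
  have := pi_pos
  exact ⟨by positivity, div_lt_self this (by linarith)⟩

theorem sin_pi_div_pos {x : ℝ} (hx : 2 ≤ x) : 0 < sin (π / x) :=
  sin_pos_of_pos_of_lt_pi (pi_div_pos_lt hx).1 (pi_div_pos_lt hx).2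

theorem hasDerivAt_cot_pi_div {x : ℝ} (hx : 2 ≤ x) :
    HasDerivAt (fun x => cot (π / x)) ((π / x / sin (π / x)) ^ 2 / π) x := by
  have hs := (sin_pi_div_pos hx).ne'
  have h1 := hasDerivAt_pi_div (x := x) (by linarith)
  simp only [cot_eq_cos_div_sin]
  refine (h1.cos.div h1.sin hs).congr_deriv ?_
  have := sin_sq_add_cos_sq (π / x)
  have hp := pi_pos.ne'
  generalize π / x = t at *
  field_simp
  linear_combination (t ^ 2) * this

theorem hasDerivAt_csc_pi_div {x : ℝ} (hx : 2 ≤ x) :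
    HasDerivAt (fun x => (sin (π / x))⁻¹)
      ((π / x / sin (π / x)) ^ 2 * cos (π / x) / π) x := by
  have hs := (sin_pi_div_pos hx).ne'
  have h1 := hasDerivAt_pi_div (x := x) (by linarith)
  refine (h1.sin.inv hs).congr_deriv ?_
  have hp := pi_pos.ne'
  generalize π / x = t at *
  field_simp

/-- Up to the factor `1 / π`, the square of this function of `t = π / x` is the derivative of
`cot (π / x)`. -/
theorem strictMonoOn_div_sin : StrictMonoOn (fun t => t / sin t) (Set.Ioo 0 (π / 2)) := by
  apply strictMonoOn_of_deriv_pos (convex_Ioo _ _)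
  · apply ContinuousOn.div continuousOn_id continuous_sin.continuousOn
    intro t ht
    exact (sin_pos_of_pos_of_lt_pi ht.1 (by linarith [ht.2, pi_pos])).ne'
  · intro t ht
    rw [interior_Ioo] at ht
    have hs := sin_pos_of_pos_of_lt_pi ht.1 (by linarith [ht.2, pi_pos])
    have hc := cos_pos_of_mem_Ioo ⟨by linarith [ht.1, pi_pos], ht.2⟩
    have h := ((hasDerivAt_id t).div (hasDerivAt_sin t) hs.ne').deriv
    have h2 : deriv (fun t => t / sin t) t = (1 * sin t - t * cos t) / sin t ^ 2 := h
    rw [h2]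
    have := lt_tan ht.1 ht.2
    rw [tan_eq_sin_div_cos, lt_div_iff₀ hc] at this
    apply div_pos (by linarith) (by positivity)

/-- Up to the factor `1 / π`, this function of `t = π / x` is the derivative of `csc (π / x)`. -/
theorem strictAntiOn_sq_div_sin_mul_cos :
    StrictAntiOn (fun t => (t / sin t) ^ 2 * cos t) (Set.Ioo 0 (π / 2)) := by
  apply strictAntiOn_of_deriv_neg (convex_Ioo _ _)
  · apply ContinuousOn.mul _ continuous_cos.continuousOn
    apply ContinuousOn.pow
    apply ContinuousOn.div continuousOn_id continuous_sin.continuousOn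
    intro t ht
    exact (sin_pos_of_pos_of_lt_pi ht.1 (by linarith [ht.2, pi_pos])).ne'
  · intro t ht
    rw [interior_Ioo] at ht
    have hs := sin_pos_of_pos_of_lt_pi ht.1 (by linarith [ht.2, pi_pos])
    have h := ((((hasDerivAt_id t).div (hasDerivAt_sin t) hs.ne').pow 2).mul
      (hasDerivAt_cos t)).deriv
    have h2 : deriv (fun t => (t / sin t) ^ 2 * cos t) t =
        -(t / sin t ^ 3) * (t * (1 + cos t ^ 2) - 2 * sin t * cos t) := by
      refine Eq.trans h ?_
      simp
      have := sin_sq_add_cos_sq t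
      field_simp
      linear_combination (-t ^ 2) * this
    rw [h2]
    have hpos : 0 < t * (1 + cos t ^ 2) - 2 * sin t * cos t := by
      have hmono : StrictMonoOn (fun t => t * (1 + cos t ^ 2) - 2 * sin t * cos t)
          (Set.Icc 0 (π / 2)) := by
        apply strictMonoOn_of_deriv_pos (convex_Icc _ _)
        · fun_prop
        · intro u hu
          rw [interior_Icc] at hu
          have hsu := sin_pos_of_pos_of_lt_pi hu.1 (by linarith [hu.2, pi_pos])
          have hcu := cos_pos_of_mem_Ioo ⟨by linarith [hu.1, pi_pos], hu.2⟩
          have hd := ((hasDerivAt_id u).mul (((hasDerivAt_cos u).pow 2).const_add 1)).sub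
            (((hasDerivAt_sin u).const_mul 2).mul (hasDerivAt_cos u))
          have hd2 : deriv (fun t => t * (1 + cos t ^ 2) - 2 * sin t * cos t) u =
              sin u * (3 * sin u - 2 * (u * cos u)) := by
            refine Eq.trans hd.deriv ?_
            simp
            linear_combination (-1) * sin_sq_add_cos_sq u
          rw [hd2]
          have := lt_tan hu.1 hu.2
          rw [tan_eq_sin_div_cos, lt_div_iff₀ hcu] at this
          apply mul_pos hsu
          nlinarith
      have := hmono (Set.left_mem_Icc.mpr (by positivity)) ⟨ht.1.le, ht.2.le⟩ ht.1
      simpa using this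
    have : 0 < t / sin t ^ 3 := div_pos ht.1 (by positivity)
    nlinarith

theorem strictConcaveOn_cot_pi_div : StrictConcaveOn ℝ (Set.Ici 2) fun x => cot (π / x) := by
  apply StrictAntiOn.strictConcaveOn_of_deriv (convex_Ici 2)
  · exact fun x hx => (hasDerivAt_cot_pi_div hx).continuousAt.continuousWithinAt
  · rw [interior_Ici]
    intro x hx y hy hxy
    rw [(hasDerivAt_cot_pi_div (le_of_lt hx)).deriv, (hasDerivAt_cot_pi_div (le_of_lt hy)).deriv]
    have hp := pi_pos
    have hx' := pi_div_mem hx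
    have hy' := pi_div_mem hy
    have hx0 : 0 < x := lt_trans two_pos hx
    have := strictMonoOn_div_sin hy' hx' (by gcongr)
    have := div_pos hy'.1 (sin_pi_div_pos (le_of_lt hy))
    simp only at *
    gcongr

theorem strictConvexOn_csc_pi_div : StrictConvexOn ℝ (Set.Ici 2) fun x => (sin (π / x))⁻¹ := by
  apply StrictMonoOn.strictConvexOn_of_deriv (convex_Ici 2)
  · exact fun x hx => (hasDerivAt_csc_pi_div hx).continuousAt.continuousWithinAt
  · rw [interior_Ici]
    intro x hx y hy hxy
    rw [(hasDerivAt_csc_pi_div (le_of_lt hx)).deriv, (hasDerivAt_csc_pi_div (le_of_lt hy)).deriv]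
    have hp := pi_pos
    have hx' := pi_div_mem hx
    have hy' := pi_div_mem hy
    have hx0 : 0 < x := lt_trans two_pos hx
    have := strictAntiOn_sq_div_sin_mul_cos hy' hx' (by gcongr)
    simp only at *
    gcongr

/-- Moving the two ends of an interval towards each other lowers a strictly convex sum. -/
theorem StrictConvexOn.add_lt_add_of_between {f : ℝ → ℝ} {s : Set ℝ} (hf : StrictConvexOn ℝ s f)
    {a b d : ℝ} (ha : a ∈ s) (hb : b ∈ s) (hd : 0 < d) (hab : a + d < b) :
    f (a + d) + f (b - d) < f a + f b := by
  have hne : b - a ≠ 0 := by linarith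
  have hw : 0 < d / (b - a) := div_pos hd (by linarith)
  have hv : 0 < 1 - d / (b - a) := by
    rw [sub_pos, div_lt_one (by linarith)]
    linarith
  have h1 := hf.2 ha hb (by linarith) hv hw (by ring)
  have h2 := hf.2 ha hb (by linarith) hw hv (by ring)
  have e1 : (1 - d / (b - a)) • a + (d / (b - a)) • b = a + d := by
    simp only [smul_eq_mul]; field_simp; ring
  have e2 : (d / (b - a)) • a + (1 - d / (b - a)) • b = b - d := by
    simp only [smul_eq_mul]; field_simp; ring
  rw [e1] at h1
  rw [e2] at h2
  simp only [smul_eq_mul] at h1 h2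
  linarith

theorem strictAntiOn_mul_cot : StrictAntiOn (fun t => t * cot t) (Set.Ioc 0 (π / 2)) := by
  simp only [cot_eq_cos_div_sin]
  have hpos : ∀ t ∈ Set.Ioc 0 (π / 2), 0 < sin t := fun t ht =>
    sin_pos_of_pos_of_lt_pi ht.1 (by linarith [ht.2, pi_pos])
  apply strictAntiOn_of_deriv_neg (convex_Ioc _ _)
  · exact continuousOn_id.mul (continuous_cos.continuousOn.div continuous_sin.continuousOn
      fun t ht => (hpos t ht).ne')
  · intro t ht
    rw [interior_Ioc] at ht
    have hs := hpos t ⟨ht.1, ht.2.le⟩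
    have hc := cos_pos_of_mem_Ioo ⟨by linarith [ht.1, pi_pos], ht.2⟩
    have hd := (hasDerivAt_id t).mul ((hasDerivAt_cos t).div (hasDerivAt_sin t) hs.ne')
    have hd2 : deriv (fun t => t * (cos t / sin t)) t = (sin t * cos t - t) / sin t ^ 2 := by
      refine Eq.trans hd.deriv ?_
      simp
      have := sin_sq_add_cos_sq t
      field_simp
      linear_combination (-t) * this
    rw [hd2]
    apply div_neg_of_neg_of_pos _ (by positivity)
    nlinarith [sin_lt ht.1, cos_le_one t]

/-- Superadditivity of `x ↦ cot (π / x)`, which holds because `cot (π / x) / x` increases. -/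
theorem cot_pi_div_add_lt {a b : ℝ} (ha : 2 ≤ a) (hb : 2 ≤ b) :
    cot (π / a) + cot (π / b) < cot (π / (a + b)) := by
  have hp := pi_pos
  have key : ∀ {x y : ℝ}, 2 ≤ x → x < y → cot (π / x) < x / y * cot (π / y) := by
    intro x y hx hxy
    have hx0 : 0 < x := by linarith
    have hy0 : 0 < y := by linarith
    have h := strictAntiOn_mul_cot (a := π / y) (b := π / x)
      ⟨by positivity, by gcongr; linarith⟩ ⟨by positivity, by gcongr⟩ (by gcongr)
    simp only at h
    have h2 := mul_lt_mul_of_pos_left h (show 0 < x / π by positivity)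
    have e1 : x / π * (π / x * cot (π / x)) = cot (π / x) := by field_simp
    have e2 : x / π * (π / y * cot (π / y)) = x / y * cot (π / y) := by field_simp
    rwa [e1, e2] at h2
  have h1 := key (y := a + b) ha (by linarith)
  have h2 := key (y := a + b) hb (by linarith)
  have e : a / (a + b) * cot (π / (a + b)) + b / (a + b) * cot (π / (a + b)) =
      cot (π / (a + b)) := by
    rw [← add_mul, ← add_div, div_self (by linarith), one_mul]
  linarith

theorem cot_pi_div_lt_csc {x : ℝ} (hx : 2 ≤ x) : cot (π / x) < (sin (π / x))⁻¹ := by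
  have hs := sin_pi_div_pos hx
  rw [cot_eq_cos_div_sin, ← one_div]
  gcongr
  have h := pi_div_pos_lt hx
  rw [← cos_zero]
  exact cos_lt_cos_of_nonneg_of_le_pi le_rfl h.2.le h.1

theorem div_pi_lt_csc {x : ℝ} (hx : 2 ≤ x) : x / π < (sin (π / x))⁻¹ := by
  have h := pi_div_pos_lt hx
  have hs := sin_pi_div_pos hx
  have := sin_lt h.1
  rw [← inv_div]
  gcongr

theorem cot_pi_div_lt_div_pi {x : ℝ} (hx : 2 < x) : cot (π / x) < x / π := by
  have h := pi_div_mem hx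
  have hc := cos_pos_of_mem_Ioo ⟨by linarith [h.1, pi_pos], h.2⟩
  have := lt_tan h.1 h.2
  rw [tan_eq_sin_div_cos, lt_div_iff₀ hc] at this
  rw [cot_eq_cos_div_sin, ← inv_div π x, ← one_div, div_lt_div_iff₀ (sin_pi_div_pos hx.le) h.1]
  linarith

/-! ### Values and numerical bounds of cotangent and cosecant at `π / x` -/

theorem cot_pi_div_two_eq : cot (π / 2) = 0 := by simp [cot_eq_cos_div_sin]

theorem cot_pi_div_four_eq : cot (π / 4) = 1 := by
  have : √2 ≠ 0 := by positivity
  rw [cot_eq_cos_div_sin, cos_pi_div_four, sin_pi_div_four]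
  exact div_self (by positivity)

theorem cot_pi_div_six_eq : cot (π / 6) = √3 := by
  rw [cot_eq_cos_div_sin, cos_pi_div_six, sin_pi_div_six]
  ring

theorem cot_pi_div_eight_eq : cot (π / 8) = 1 + √2 := by
  have hs : sin (π / 8) ≠ 0 := by
    exact_mod_cast (sin_pi_div_pos (x := 8) (by norm_num)).ne'
  have h1 := sin_two_mul (π / 8)
  have h2 := cos_sq (π / 8)
  have h3 := sin_sq_add_cos_sq (π / 8)
  rw [show 2 * (π / 8) = π / 4 by ring] at h1 h2
  rw [sin_pi_div_four] at h1
  rw [cos_pi_div_four] at h2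
  rw [cot_eq_cos_div_sin, div_eq_iff hs]
  have hc : 0 < cos (π / 8) := cos_pos_of_mem_Ioo ⟨by linarith [pi_pos], by linarith [pi_pos]⟩
  apply mul_left_cancel₀ hc.ne'
  have h5 : √2 * √2 = 2 := mul_self_sqrt (by norm_num)
  linear_combination h2 + (1 + √2) / 2 * h1 - h5 / 4

theorem csc_pi_div_four_eq : (sin (π / 4))⁻¹ = √2 := by
  rw [sin_pi_div_four, inv_div, div_eq_iff (by positivity)]
  exact (mul_self_sqrt (by norm_num)).symm

theorem pi_div_le_one {x : ℝ} (hx : 4 ≤ x) : 0 < π / x ∧ π / x ≤ 1 := by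
  have := pi_pos
  exact ⟨by positivity, by rw [div_le_one (by linarith)]; linarith [pi_le_four]⟩

theorem cot_pi_div_le {x : ℝ} (hx : 4 ≤ x) : cot (π / x) ≤ x * π⁻¹ - π / (3 * x) := by
  have h := pi_div_le_one hx
  refine (cot_le_laurent h.1 h.2).trans_eq ?_
  have := pi_pos.ne'
  field_simp

theorem le_cot_pi_div {x : ℝ} (hx : 4 ≤ x) :
    x * π⁻¹ - π / (3 * x) - π ^ 3 / (40 * x ^ 3) ≤ cot (π / x) := by
  have h := pi_div_le_one hx
  refine Eq.trans_le ?_ (laurent_le_cot h.1 h.2)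
  have := pi_pos.ne'
  field_simp

theorem le_csc_pi_div {x : ℝ} (hx : 4 ≤ x) : x * π⁻¹ + π / (6 * x) ≤ (sin (π / x))⁻¹ := by
  have h := pi_div_le_one hx
  refine Eq.trans_le ?_ (laurent_le_csc h.1 h.2)
  have := pi_pos.ne'
  field_simp

theorem csc_pi_div_le {x : ℝ} (hx : 4 ≤ x) :
    (sin (π / x))⁻¹ ≤ x * π⁻¹ + π / (6 * x) + π ^ 3 / (45 * x ^ 3) := by
  have h := pi_div_le_one hx
  refine (csc_le_laurent h.1 h.2).trans_eq ?_
  have := pi_pos.ne'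
  field_simp

theorem inv_pi_bounds : 0.318309 < π⁻¹ ∧ π⁻¹ < 0.318311 := by
  have h := pi_pos
  constructor
  · rw [lt_inv_comm₀ (by norm_num) h]
    exact pi_lt_d6.trans (by norm_num)
  · rw [inv_lt_comm₀ h (by norm_num)]
    exact lt_trans (by norm_num) pi_gt_d6

theorem pi_cube_bounds : 31 < π ^ 3 ∧ π ^ 3 < 31.01 := by
  constructor
  · calc (31 : ℝ) < 3.1415 ^ 3 := by norm_num
      _ < π ^ 3 := by gcongr; exact pi_gt_d4
  · calc π ^ 3 < 3.1416 ^ 3 := by gcongr; exact pi_lt_d4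
      _ < 31.01 := by norm_num

theorem sqrt_two_bounds : 1.4142 < √2 ∧ √2 < 1.4143 := by
  constructor
  · exact lt_sqrt_of_sq_lt (by norm_num)
  · rw [sqrt_lt' (by norm_num)]; norm_num

theorem sqrt_three_bounds : 1.73205 < √3 ∧ √3 < 1.73206 := by
  constructor
  · exact lt_sqrt_of_sq_lt (by norm_num)
  · rw [sqrt_lt' (by norm_num)]; norm_num

/-- This gives `P(6, M - 6) > N(2, M - 4)`, with `x = M - 6`. The difference tends to
`√3 - 1 - 2 / π`, about `0.095`, and at `x = 16` it is below `0.001`; the inequality fails at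
`x = 14`, which is why the regular part of the ordering begins at `M = 22`. -/
theorem one_add_csc_lt_sqrt_three_add_cot {x : ℝ} (hx : 16 ≤ x) :
    1 + (sin (π / (x + 2)))⁻¹ < √3 + cot (π / x) := by
  have h1 := le_cot_pi_div (x := x) (by linarith)
  have h2 := csc_pi_div_le (x := x + 2) (by linarith)
  have hp := pi_pos
  have b1 : π / (3 * x) ≤ π / (3 * 16) := by gcongr
  have b2 : π ^ 3 / (40 * x ^ 3) ≤ π ^ 3 / (40 * 16 ^ 3) := by gcongr
  have b3 : π / (6 * (x + 2)) ≤ π / (6 * 18) := by gcongr; linarith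
  have b4 : π ^ 3 / (45 * (x + 2) ^ 3) ≤ π ^ 3 / (45 * 18 ^ 3) := by gcongr; linarith
  linarith [inv_pi_bounds.2, pi_cube_bounds.2, sqrt_three_bounds.1, pi_lt_d6]

/-- This gives `P(4, M - 4) > N(4, M - 6)`, with `x = M - 6`. -/
theorem sqrt_two_add_csc_lt_one_add_cot {x : ℝ} (hx : 16 ≤ x) :
    √2 + (sin (π / x))⁻¹ < 1 + cot (π / (x + 2)) := by
  have h1 := le_cot_pi_div (x := x + 2) (by linarith)
  have h2 := csc_pi_div_le (x := x) (by linarith)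
  have hp := pi_pos
  have b1 : π / (6 * x) ≤ π / (6 * 16) := by gcongr
  have b2 : π ^ 3 / (45 * x ^ 3) ≤ π ^ 3 / (45 * 16 ^ 3) := by gcongr
  have b3 : π / (3 * (x + 2)) ≤ π / (3 * 18) := by gcongr; linarith
  have b4 : π ^ 3 / (40 * (x + 2) ^ 3) ≤ π ^ 3 / (40 * 18 ^ 3) := by gcongr; linarith
  linarith [inv_pi_bounds.1, pi_cube_bounds.2, sqrt_two_bounds.2, pi_lt_d6]

/-! ### Comparison of energies of cycle pairs -/

namespace CyclePair

open SignedDigraph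

theorem energy_pos_eq {a b : ℕ} (ha : 2 ≤ a) (hb : 2 ≤ b) (ea : Even a) (eb : Even b) :
    (pos a b).energy = 2 * cot (π / a) + 2 * cot (π / b) := by
  rw [energy, iotaEnergy_signedCycle_one ha ea, iotaEnergy_signedCycle_one hb eb]

theorem energy_neg_eq {a b : ℕ} (ha : 2 ≤ a) (hb : 2 ≤ b) (ea : Even a) (eb : Even b) :
    (neg a b).energy = 2 * (sin (π / a))⁻¹ + 2 * (sin (π / b))⁻¹ := by
  rw [energy, iotaEnergy_signedCycle_neg_one ha ea, iotaEnergy_signedCycle_neg_one hb eb]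

/-- Merging two positive cycles into one raises the energy. -/
theorem energy_pos_lt_of_add_eq {a b M : ℕ} (ha : 2 ≤ a) (hb : 2 ≤ b) (ea : Even a) (eb : Even b)
    (h : a + b = M) : (pos a b).energy < 2 * cot (π / M) := by
  have := cot_pi_div_add_lt (a := a) (b := b) (by exact_mod_cast ha) (by exact_mod_cast hb)
  rw [energy_pos_eq ha hb ea eb, ← h]
  push_cast
  linarith

theorem energy_pos_two {b : ℕ} (hb : 2 ≤ b) (eb : Even b) :
    (pos 2 b).energy = 2 * cot (π / b) := by
  rw [energy_pos_eq le_rfl hb even_two eb]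
  push_cast
  rw [cot_pi_div_two_eq]
  ring

/-- Both energies are compared with `2 * M / π`, since `cot t < 1 / t < csc t`. -/
theorem lt_energy_neg_of_add_eq {a b M : ℕ} (ha : 2 ≤ a) (hb : 2 ≤ b) (ea : Even a) (eb : Even b)
    (h : a + b = M) : 2 * cot (π / M) < (neg a b).energy := by
  have h1 := div_pi_lt_csc (x := a) (by exact_mod_cast ha)
  have h2 := div_pi_lt_csc (x := b) (by exact_mod_cast hb)
  have h3 := cot_pi_div_lt_div_pi (x := M) (by exact_mod_cast (show 2 < M by omega))
  rw [energy_neg_eq ha hb ea eb]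
  have : (M : ℝ) / π = a / π + b / π := by rw [← h]; push_cast; ring
  linarith

theorem energy_neg_step {a N : ℕ} (ha : 2 ≤ a) (ea : Even a) (eN : Even N) (h : 2 * (a + 2) ≤ N) :
    (neg (a + 2) (N - (a + 2))).energy < (neg a (N - a)).energy := by
  rw [energy_neg_eq ha (by omega) ea (by grind), energy_neg_eq (by omega) (by omega) (by grind)
    (by grind)]
  have hN : ((2 * (a + 2) : ℕ) : ℝ) ≤ N := by exact_mod_cast h
  have ha' : (2 : ℝ) ≤ a := by exact_mod_cast ha
  rw [Nat.cast_sub (by omega), Nat.cast_sub (by omega)]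
  push_cast at hN ⊢
  have := strictConvexOn_csc_pi_div.add_lt_add_of_between (a := a) (b := N - a) (d := 2)
    ha' (show (2 : ℝ) ≤ N - a by linarith) two_pos (by linarith)
  rw [show (N : ℝ) - a - 2 = N - (a + 2) by ring] at this
  linarith

theorem energy_pos_step {a N : ℕ} (ha : 2 ≤ a) (ea : Even a) (eN : Even N) (h : 2 * (a + 2) ≤ N) :
    (pos a (N - a)).energy < (pos (a + 2) (N - (a + 2))).energy := by
  rw [energy_pos_eq ha (by omega) ea (by grind), energy_pos_eq (by omega) (by omega) (by grind)
    (by grind)]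
  have hN : ((2 * (a + 2) : ℕ) : ℝ) ≤ N := by exact_mod_cast h
  have ha' : (2 : ℝ) ≤ a := by exact_mod_cast ha
  rw [Nat.cast_sub (by omega), Nat.cast_sub (by omega)]
  push_cast at hN ⊢
  have := strictConcaveOn_cot_pi_div.neg.add_lt_add_of_between (a := a) (b := N - a) (d := 2)
    ha' (show (2 : ℝ) ≤ N - a by linarith) two_pos (by linarith)
  rw [show (N : ℝ) - a - 2 = N - (a + 2) by ring] at this
  simp only [Pi.neg_apply] at this
  linarith

theorem energy_pos_six_gt_neg_two {M : ℕ} (hM : 22 ≤ M) (eM : Even M) :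
    (neg 2 (M - 4)).energy < (pos 6 (M - 6)).energy := by
  rw [energy_neg_eq le_rfl (by omega) even_two (by grind), energy_pos_eq (by omega) (by omega)
    (by decide) (by grind), Nat.cast_sub (by omega), Nat.cast_sub (by omega)]
  have hM' : (22 : ℝ) ≤ M := by exact_mod_cast hM
  have := one_add_csc_lt_sqrt_three_add_cot (x := M - 6) (by linarith)
  rw [show (M : ℝ) - 6 + 2 = M - 4 by ring] at this
  push_cast
  rw [sin_pi_div_two, cot_pi_div_six_eq]
  linarith

theorem energy_neg_two_gt_pos_four {M : ℕ} (hM : 22 ≤ M) (eM : Even M) :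
    (pos 4 (M - 4)).energy < (neg 2 (M - 4)).energy := by
  rw [energy_neg_eq le_rfl (by omega) even_two (by grind), energy_pos_eq (by omega) (by omega)
    (by decide) (by grind)]
  have := cot_pi_div_lt_csc (x := (M - 4 : ℕ)) (by exact_mod_cast (show 2 ≤ M - 4 by omega))
  rw [Nat.cast_ofNat, Nat.cast_ofNat, sin_pi_div_two, cot_pi_div_four_eq]
  linarith

theorem energy_pos_four_gt_neg_four {M : ℕ} (hM : 22 ≤ M) (eM : Even M) :
    (neg 4 (M - 6)).energy < (pos 4 (M - 4)).energy := by
  rw [energy_neg_eq (by omega) (by omega) (by decide) (by grind), energy_pos_eq (by omega)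
    (by omega) (by decide) (by grind), Nat.cast_sub (by omega), Nat.cast_sub (by omega)]
  have hM' : (22 : ℝ) ≤ M := by exact_mod_cast hM
  have := sqrt_two_add_csc_lt_one_add_cot (x := M - 6) (by linarith)
  rw [show (M : ℝ) - 6 + 2 = M - 4 by ring] at this
  push_cast
  rw [csc_pi_div_four_eq, cot_pi_div_four_eq]
  linarith

/-! ### The chains for at least 22 vertices -/

theorem isChain_negDown {N : ℕ} (eN : Even N) :
    (negDown N).IsChain fun p q => p.energy > q.energy := by
  rw [negDown, List.isChain_map, List.isChain_range]
  intro i hi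
  exact energy_neg_step (a := 2 * i + 4) (by omega) (by grind) eN (by omega)

theorem isChain_posDown {N : ℕ} (eN : Even N) :
    (posDown N).IsChain fun p q => p.energy > q.energy := by
  rw [posDown, List.isChain_reverse, List.isChain_map, List.isChain_range]
  intro i hi
  exact energy_pos_step (a := 2 * i + 6) (by omega) (by grind) eN (by omega)

theorem mem_negDown {N : ℕ} {p : CyclePair} :
    p ∈ negDown N ↔ ∃ a, Even a ∧ 4 ≤ a ∧ 2 * a ≤ N ∧ p = neg a (N - a) := by
  simp only [negDown, List.mem_map, List.mem_range]
  constructor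
  · rintro ⟨i, hi, rfl⟩
    exact ⟨2 * i + 4, by grind, by omega, by omega, rfl⟩
  · rintro ⟨a, ⟨k, rfl⟩, h1, h2, rfl⟩
    exact ⟨k - 2, by omega, by rw [show 2 * (k - 2) + 4 = k + k by omega]⟩

theorem mem_posDown {N : ℕ} {p : CyclePair} :
    p ∈ posDown N ↔ ∃ a, Even a ∧ 6 ≤ a ∧ 2 * a ≤ N ∧ p = pos a (N - a) := by
  simp only [posDown, List.mem_reverse, List.mem_map, List.mem_range]
  constructor
  · rintro ⟨i, hi, rfl⟩
    exact ⟨2 * i + 6, by grind, by omega, by omega, rfl⟩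
  · rintro ⟨a, ⟨k, rfl⟩, h1, h2, rfl⟩
    exact ⟨k - 3, by omega, by rw [show 2 * (k - 3) + 6 = k + k by omega]⟩

theorem head?_negDown {N : ℕ} (hN : 8 ≤ N) : (negDown N).head? = some (neg 4 (N - 4)) := by
  obtain ⟨k, hk⟩ : ∃ k, N / 4 - 1 = k + 1 := ⟨N / 4 - 2, by omega⟩
  rw [negDown, hk, List.range_succ_eq_map]
  rfl

theorem getLast?_posDown {N : ℕ} (hN : 12 ≤ N) :
    (posDown N).getLast? = some (pos 6 (N - 6)) := by
  obtain ⟨k, hk⟩ : ∃ k, N / 4 - 2 = k + 1 := ⟨N / 4 - 3, by omega⟩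
  rw [posDown, hk, List.getLast?_reverse, List.range_succ_eq_map]
  rfl

theorem isChain_segment {M : ℕ} (hM : 22 ≤ M) (eM : Even M) :
    (segment M).IsChain fun p q => p.energy > q.energy := by
  have e2 : Even (M - 2) := by grind
  rw [segment, List.append_assoc, List.append_assoc, List.isChain_append]
  refine ⟨isChain_posDown eM, ?_, ?_⟩
  · simp only [List.cons_append, List.nil_append, List.isChain_cons_cons]
    refine ⟨energy_neg_two_gt_pos_four hM eM, ?_⟩
    rw [List.isChain_cons, List.isChain_append]
    refine ⟨?_, isChain_negDown e2, List.isChain_singleton _, ?_⟩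
    · intro q hq
      rw [List.head?_append, head?_negDown (by omega)] at hq
      cases hq
      rw [show M - 2 - 4 = M - 6 by omega]
      exact energy_pos_four_gt_neg_four hM eM
    · intro p hp q hq
      obtain ⟨a, ea, ha, ha', rfl⟩ := mem_negDown.1 (List.mem_of_mem_getLast? hp)
      cases hq
      rw [energy_pos_two (by omega) e2]
      exact lt_energy_neg_of_add_eq (by omega) (by omega) ea (by grind) (by omega)
  · intro p hp q hq
    rw [getLast?_posDown (by omega)] at hp
    cases hp
    cases hq
    exact energy_pos_six_gt_neg_two hM eM

theorem exists_of_mem_head?_segment_append {M : ℕ} (hM : 22 ≤ M) (eM : Even M)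
    {l : List CyclePair} {p : CyclePair} (hp : p ∈ (segment M ++ l).head?) :
    ∃ a b, 2 ≤ a ∧ 2 ≤ b ∧ Even a ∧ Even b ∧ a + b = M ∧ p = pos a b := by
  have hne : posDown M ≠ [] := by
    intro h
    have := getLast?_posDown (N := M) (by omega)
    simp [h] at this
  rw [segment, List.append_assoc, List.append_assoc, List.append_assoc,
    List.head?_append_of_ne_nil _ hne] at hp
  obtain ⟨a, ea, ha, ha', rfl⟩ := mem_posDown.1 (List.mem_of_mem_head? hp)
  exact ⟨a, M - a, by omega, by omega, ea, by grind, by omega, rfl⟩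

theorem flatMap_segment_succ (k M : ℕ) :
    ((List.range (k + 1)).flatMap fun i => segment (M - 2 * i)) =
      segment M ++ (List.range k).flatMap fun i => segment (M - 2 - 2 * i) := by
  rw [List.range_succ_eq_map, List.flatMap_cons, List.flatMap_map]
  simp only [Nat.succ_eq_add_one, mul_add, Nat.sub_sub, mul_zero, Nat.sub_zero, mul_one,
    Nat.add_comm 2]

theorem isChain_flatMap_segment (k M : ℕ) (hM : 22 + 2 * k ≤ M) (eM : Even M) :
    ((List.range (k + 1)).flatMap fun i => segment (M - 2 * i)).IsChain
      fun p q => p.energy > q.energy := by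
  induction k generalizing M with
  | zero => simpa using isChain_segment (by omega) eM
  | succ k ih =>
    have e2 : Even (M - 2) := by grind
    rw [flatMap_segment_succ, List.isChain_append]
    refine ⟨isChain_segment (by omega) eM, ih _ (by omega) e2, fun p hp q hq => ?_⟩
    rw [flatMap_segment_succ] at hq
    obtain ⟨a, b, ha, hb, ea, eb, hab, rfl⟩ :=
      exists_of_mem_head?_segment_append (by omega) e2 hq
    rw [segment, List.getLast?_concat] at hp
    cases hp
    rw [energy_pos_two (by omega) e2]
    exact energy_pos_lt_of_add_eq ha hb ea eb hab

theorem isChain_upperChain {m : ℕ} (hm : 22 ≤ m) (em : Even m) :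
    (upperChain m).IsChain fun p q => p.energy > q.energy := by
  rw [upperChain, List.isChain_append]
  refine ⟨?_, isChain_flatMap_segment _ _ (by omega) em, fun p hp q hq => ?_⟩
  · rw [List.isChain_cons]
    refine ⟨fun q hq => ?_, isChain_negDown em⟩
    rw [head?_negDown (by omega)] at hq
    cases hq
    exact energy_neg_step le_rfl even_two em (by omega)
  · rw [flatMap_segment_succ] at hq
    obtain ⟨a, b, ha, hb, ea, eb, hab, rfl⟩ :=
      exists_of_mem_head?_segment_append (by omega) em hq
    have h1 := energy_pos_lt_of_add_eq ha hb ea eb hab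
    rcases List.mem_cons.1 (List.mem_of_mem_getLast? hp) with rfl | h
    · exact h1.trans (lt_energy_neg_of_add_eq le_rfl (by omega) even_two (by grind) (by omega))
    · obtain ⟨c, ec, hc, hc', rfl⟩ := mem_negDown.1 h
      exact h1.trans (lt_energy_neg_of_add_eq (by omega) (by omega) ec (by grind) (by omega))

/-! ### The explicit chain -/

/-- Numerical values of the energies of short positive cycles. Exact values are
needed for the coincidences `P(4, 8) = N(4, 6)`, `P(2, 8) = N(2, 4)` and `P(4, 4) = N(2, 2)`. -/
theorem energy_table_pos :
    (signedCycle 2 1).iotaEnergy = 0 ∧ (signedCycle 4 1).iotaEnergy = 2 ∧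
    (signedCycle 6 1).iotaEnergy = 2 * √3 ∧ (signedCycle 8 1).iotaEnergy = 2 + 2 * √2 ∧
    (6.155 < (signedCycle 10 1).iotaEnergy ∧ (signedCycle 10 1).iotaEnergy < 6.157) ∧
    (7.463 < (signedCycle 12 1).iotaEnergy ∧ (signedCycle 12 1).iotaEnergy < 7.466) ∧
    (8.762 < (signedCycle 14 1).iotaEnergy ∧ (signedCycle 14 1).iotaEnergy < 8.764) ∧
    (10.054 < (signedCycle 16 1).iotaEnergy ∧ (signedCycle 16 1).iotaEnergy < 10.056) ∧
    (11.342 < (signedCycle 18 1).iotaEnergy ∧ (signedCycle 18 1).iotaEnergy < 11.344) ∧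
    (12.627 < (signedCycle 20 1).iotaEnergy ∧ (signedCycle 20 1).iotaEnergy < 12.628) := by
  have key : ∀ r : ℕ, 4 ≤ r → Even r →
      2 * (r * π⁻¹ - π / (3 * r) - π ^ 3 / (40 * r ^ 3)) ≤ (signedCycle r 1).iotaEnergy ∧
      (signedCycle r 1).iotaEnergy ≤ 2 * (r * π⁻¹ - π / (3 * r)) := by
    intro r hr er
    have hr' : (4 : ℝ) ≤ r := by exact_mod_cast hr
    rw [iotaEnergy_signedCycle_one (by omega) er]
    exact ⟨by linarith [le_cot_pi_div hr'], by linarith [cot_pi_div_le hr']⟩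
  have b1 := inv_pi_bounds
  have b2 := pi_cube_bounds
  have b3 := pi_gt_d4
  have b4 := pi_lt_d4
  refine ⟨?_, ?_, ?_, ?_, ?_, ?_, ?_, ?_, ?_, ?_⟩
  · rw [iotaEnergy_signedCycle_one le_rfl even_two, Nat.cast_ofNat, cot_pi_div_two_eq, mul_zero]
  · rw [iotaEnergy_signedCycle_one (by omega) (by decide), Nat.cast_ofNat, cot_pi_div_four_eq,
      mul_one]
  · rw [iotaEnergy_signedCycle_one (by omega) (by decide), Nat.cast_ofNat, cot_pi_div_six_eq]
  · rw [iotaEnergy_signedCycle_one (by omega) (by decide), Nat.cast_ofNat, cot_pi_div_eight_eq]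
    ring
  · have h := key 10 (by omega) (by decide)
    push_cast at h
    constructor <;> linarith
  · have h := key 12 (by omega) (by decide)
    push_cast at h
    constructor <;> linarith
  · have h := key 14 (by omega) (by decide)
    push_cast at h
    constructor <;> linarith
  · have h := key 16 (by omega) (by decide)
    push_cast at h
    constructor <;> linarith
  · have h := key 18 (by omega) (by decide)
    push_cast at h
    constructor <;> linarith
  · have h := key 20 (by omega) (by decide)
    push_cast at h
    constructor <;> linarith

/-- Numerical values of the energies of short negative cycles. -/
theorem energy_table_neg :
    (signedCycle 2 (-1)).iotaEnergy = 2 ∧ (signedCycle 4 (-1)).iotaEnergy = 2 * √2 ∧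
    (signedCycle 6 (-1)).iotaEnergy = 4 ∧
    (5.223 < (signedCycle 8 (-1)).iotaEnergy ∧ (signedCycle 8 (-1)).iotaEnergy < 5.228) ∧
    (6.470 < (signedCycle 10 (-1)).iotaEnergy ∧ (signedCycle 10 (-1)).iotaEnergy < 6.474) ∧
    (7.726 < (signedCycle 12 (-1)).iotaEnergy ∧ (signedCycle 12 (-1)).iotaEnergy < 7.729) ∧
    (8.987 < (signedCycle 14 (-1)).iotaEnergy ∧ (signedCycle 14 (-1)).iotaEnergy < 8.989) ∧
    (10.251 < (signedCycle 16 (-1)).iotaEnergy ∧ (signedCycle 16 (-1)).iotaEnergy < 10.253) := by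
  have key : ∀ r : ℕ, 4 ≤ r → Even r →
      2 * (r * π⁻¹ + π / (6 * r)) ≤ (signedCycle r (-1)).iotaEnergy ∧
      (signedCycle r (-1)).iotaEnergy ≤
        2 * (r * π⁻¹ + π / (6 * r) + π ^ 3 / (45 * r ^ 3)) := by
    intro r hr er
    have hr' : (4 : ℝ) ≤ r := by exact_mod_cast hr
    rw [iotaEnergy_signedCycle_neg_one (by omega) er]
    exact ⟨by linarith [le_csc_pi_div hr'], by linarith [csc_pi_div_le hr']⟩
  have b1 := inv_pi_bounds
  have b2 := pi_cube_bounds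
  have b3 := pi_gt_d4
  have b4 := pi_lt_d4
  refine ⟨?_, ?_, ?_, ?_, ?_, ?_, ?_, ?_⟩
  · rw [iotaEnergy_signedCycle_neg_one le_rfl even_two, Nat.cast_ofNat, sin_pi_div_two]
    norm_num
  · rw [iotaEnergy_signedCycle_neg_one (by omega) (by decide), Nat.cast_ofNat, csc_pi_div_four_eq]
  · rw [iotaEnergy_signedCycle_neg_one (by omega) (by decide), Nat.cast_ofNat, sin_pi_div_six]
    norm_num
  · have h := key 8 (by omega) (by decide)
    push_cast at h
    constructor <;> linarith
  · have h := key 10 (by omega) (by decide)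
    push_cast at h
    constructor <;> linarith
  · have h := key 12 (by omega) (by decide)
    push_cast at h
    constructor <;> linarith
  · have h := key 14 (by omega) (by decide)
    push_cast at h
    constructor <;> linarith
  · have h := key 16 (by omega) (by decide)
    push_cast at h
    constructor <;> linarith

theorem lowerChain_level_eq : ∀ l ∈ lowerChain, ∀ p ∈ l, ∀ q ∈ l, p.energy = q.energy := by
  obtain ⟨f2, f4, f6, f8, -⟩ := energy_table_pos
  obtain ⟨g2, g4, g6, -⟩ := energy_table_neg
  simp only [lowerChain, List.forall_mem_cons, List.not_mem_nil, IsEmpty.forall_iff, implies_true,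
    and_true, energy, f2, f4, f8, g2, g4, g6, true_and]
  and_intros <;> ring

theorem isChain_lowerChain :
    lowerChain.IsChain fun l l' => ∀ p ∈ l, ∀ q ∈ l', p.energy > q.energy := by
  obtain ⟨f2, f4, f6, f8, f10, f12, f14, f16, f18, f20⟩ := energy_table_pos
  obtain ⟨g2, g4, g6, g8, g10, g12, g14, g16⟩ := energy_table_neg
  have h2 := sqrt_two_bounds
  have h3 := sqrt_three_bounds
  simp only [lowerChain, List.isChain_cons_cons, List.isChain_singleton, List.forall_mem_cons,
    List.not_mem_nil, IsEmpty.forall_iff, implies_true, and_true, energy, f2, f4, f6, f8, g2, g4,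
    g6]
  and_intros <;> linarith

end CyclePair

end Trigonometry

/-! ### A digraph with two prescribed cycles -/

namespace SignedDigraph

variable {V : Type*}

/-- A directed cycle inside a set of vertices that carries only the arcs of the cycle `d` has the
arcs of `d`. -/
theorem IsDirectedCycle.cycleArcs_eq {S : SignedDigraph V} {r s : ℕ} {c : Fin r → V}
    {d : Fin s → V} (hc : S.IsDirectedCycle c) (hmem : ∀ j, c j ∈ Set.range d)
    (hd : ∀ i i', S.Arc (d i) (d i') → i' = finRotate s i) : cycleArcs c = cycleArcs d := by
  have hstep : ∀ i j, c j = d i → c (finRotate r j) = d (finRotate s i) := by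
    intro i j hij
    obtain ⟨i', hi'⟩ := hmem (finRotate r j)
    have := hc.arc j
    rw [hij, ← hi'] at this
    rw [← hi', hd _ _ this]
  apply Set.Subset.antisymm
  · rintro _ ⟨j, rfl⟩
    obtain ⟨i, hi⟩ := hmem j
    exact ⟨i, by simp only [hstep i j hi.symm, hi]⟩
  · rintro _ ⟨i, rfl⟩
    obtain ⟨i₀, hi₀⟩ := hmem ⟨0, hc.pos⟩
    obtain ⟨j, hj⟩ : ∃ j, c j = d i := by
      refine finRotate_induction (p := fun i => ∃ j, c j = d i) ?_ ⟨_, hi₀.symm⟩ i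
      rintro i ⟨j, hj⟩
      exact ⟨_, hstep i j hj⟩
    exact ⟨j, by simp only [hstep i j hj, hj]⟩

/-- A function that does not decrease along arcs is constant on every directed cycle. -/
theorem IsDirectedCycle.level_eq {S : SignedDigraph V} {r : ℕ} {c : Fin r → V}
    (hc : S.IsDirectedCycle c) {L : V → ℕ} (hL : ∀ u v, S.Arc u v → L u ≤ L v) (i j : Fin r) :
    L (c i) = L (c j) := by
  have key : ∀ i j, L (c i) ≤ L (c j) := fun i j =>
    finRotate_induction (p := fun j => L (c i) ≤ L (c j))
      (fun k hk => hk.trans (hL _ _ (hc.arc k))) le_rfl j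
  exact le_antisymm (key i j) (key j i)

/-- The directed path `0 → 1 → ⋯ → n - 1` with two more arcs, `a - 1 → 0` and `a + b - 1 → a`,
which close two disjoint cycles of lengths `a` and `b`. The two closing arcs have sign `ε`, the
others are positive. -/
def pathWithTwoCycles (n a b : ℕ) (ε : ℤˣ) : SignedDigraph (Fin n) where
  Arc u v := (v : ℕ) = u + 1 ∨ ((u : ℕ) + 1 = a ∧ (v : ℕ) = 0) ∨
    ((u : ℕ) + 1 = a + b ∧ (v : ℕ) = a)
  sign u v := if (v : ℕ) = u + 1 then 1 else ε

theorem connected_pathWithTwoCycles {n a b : ℕ} (hn : 0 < n) (ε : ℤˣ) :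
    (SimpleGraph.fromRel (pathWithTwoCycles n a b ε).Arc).Connected := by
  rw [SimpleGraph.connected_iff_exists_forall_reachable]
  refine ⟨⟨0, hn⟩, ?_⟩
  rintro ⟨k, hk⟩
  induction k with
  | zero => rfl
  | succ k ih =>
    refine (ih (by omega)).trans (SimpleGraph.Adj.reachable ?_)
    rw [SimpleGraph.fromRel_adj]
    exact ⟨by simp, Or.inl (Or.inl rfl)⟩

/-- The cycle of length `r` on the vertices `k, …, k + r - 1`. -/
def shiftedCycle {n : ℕ} (k r : ℕ) (h : k + r ≤ n) (i : Fin r) : Fin n :=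
  ⟨k + i, by omega⟩

theorem shiftedCycle_injective {n k r : ℕ} (h : k + r ≤ n) :
    Function.Injective (shiftedCycle k r h) := by
  intro i j hij
  have := congrArg Fin.val hij
  simp only [shiftedCycle] at this
  exact Fin.ext (by omega)

theorem val_finRotate_eq {r : ℕ} (i : Fin r) :
    ((finRotate r i : ℕ) = i + 1 ∧ (i : ℕ) + 1 < r) ∨
      ((finRotate r i : ℕ) = 0 ∧ (i : ℕ) + 1 = r) := by
  rcases Nat.lt_or_ge ((i : ℕ) + 1) r with h | h
  · exact Or.inl ⟨finRotate_val_of_lt h, h⟩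
  · exact Or.inr ⟨finRotate_val_of_eq (by omega), by omega⟩

theorem cycleSign_shiftedCycle {n a b k r : ℕ} (hr : 0 < r) (h : k + r ≤ n) (ε : ℤˣ) :
    (pathWithTwoCycles n a b ε).cycleSign (shiftedCycle k r h) = ε := by
  rw [cycleSign]
  refine (Finset.prod_congr rfl fun i _ => ?_).trans (prod_signedCycle hr ε)
  simp only [pathWithTwoCycles, shiftedCycle]
  have := val_finRotate_eq i
  split_ifs <;> first | rfl | omega

/-- The function that is `0` on the first cycle, `1` on the second one, and increasing on the later
vertices does not decrease along arcs, so every directed cycle stays on one of its levels. -/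
theorem isBicyclicEven_pathWithTwoCycles {n a b : ℕ} (ha : 2 ≤ a) (hb : 2 ≤ b) (ea : Even a)
    (eb : Even b) (h : a + b ≤ n) (ε : ℤˣ) :
    (pathWithTwoCycles n a b ε).IsBicyclicEven a b ε ε := by
  set S := pathWithTwoCycles n a b ε with hS
  have h₁ : S.IsDirectedCycle (shiftedCycle 0 a (by omega)) := by
    refine ⟨by omega, shiftedCycle_injective _, fun i => ?_⟩
    have := val_finRotate_eq i
    simp only [hS, pathWithTwoCycles, shiftedCycle]
    omega
  have h₂ : S.IsDirectedCycle (shiftedCycle a b h) := by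
    refine ⟨by omega, shiftedCycle_injective _, fun i => ?_⟩
    have := val_finRotate_eq i
    simp only [hS, pathWithTwoCycles, shiftedCycle]
    omega
  refine ⟨connected_pathWithTwoCycles (by omega) ε, ea, eb, _, _, h₁, h₂, ?_, ?_,
    cycleSign_shiftedCycle (by omega) _ ε, cycleSign_shiftedCycle (by omega) _ ε⟩
  · rw [Set.disjoint_left]
    rintro _ ⟨i, rfl⟩ ⟨j, hj⟩
    have := congrArg Fin.val hj
    simp only [shiftedCycle] at this
    omega
  · ext A
    constructor
    · rintro ⟨r, c, hc, rfl⟩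
      let L : Fin n → ℕ := fun u => if (u : ℕ) < a then 0 else if (u : ℕ) < a + b then 1 else u
      have hL : ∀ u v, S.Arc u v → L u ≤ L v := by
        intro u v huv
        simp only [hS, pathWithTwoCycles] at huv
        simp only [L]
        split_ifs <;> omega
      have hlev := fun j => hc.level_eq hL j ⟨0, hc.pos⟩
      have harc := hc.arc ⟨0, hc.pos⟩
      have hnext := hlev (finRotate r ⟨0, hc.pos⟩)
      generalize c ⟨0, hc.pos⟩ = u at *
      rcases Nat.lt_or_ge (u : ℕ) a with hu | hu
      · left
        apply hc.cycleArcs_eq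
        · intro j
          have hj := hlev j
          simp only [L] at hj
          have : (c j : ℕ) < a := by split_ifs at hj <;> omega
          exact ⟨⟨c j, this⟩, Fin.ext (by simp [shiftedCycle])⟩
        · intro i i' hii
          have := val_finRotate_eq i
          simp only [hS, pathWithTwoCycles, shiftedCycle] at hii
          exact Fin.ext (by omega)
      · rcases Nat.lt_or_ge (u : ℕ) (a + b) with hu' | hu'
        · right
          apply hc.cycleArcs_eq
          · intro j
            have hj := hlev j
            simp only [L] at hj
            have : (c j : ℕ) - a < b ∧ a ≤ c j := by split_ifs at hj <;> omega
            exact ⟨⟨c j - a, this.1⟩, Fin.ext (by simp only [shiftedCycle]; omega)⟩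
          · intro i i' hii
            have := val_finRotate_eq i
            simp only [hS, pathWithTwoCycles, shiftedCycle] at hii
            exact Fin.ext (by omega)
        · exfalso
          simp only [L] at hnext
          simp only [hS, pathWithTwoCycles] at harc
          split_ifs at hnext <;> omega
    · rintro (rfl | rfl)
      exacts [⟨_, _, h₁, rfl⟩, ⟨_, _, h₂, rfl⟩]

/-! ### Completeness of the ordering -/

theorem IsBicyclicEven.symm {S : SignedDigraph V} {a b : ℕ} {ε₁ ε₂ : ℤˣ}
    (h : S.IsBicyclicEven a b ε₁ ε₂) : S.IsBicyclicEven b a ε₂ ε₁ := by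
  obtain ⟨hconn, ha, hb, c₁, c₂, h₁, h₂, hdisj, hcyc, hs₁, hs₂⟩ := h
  exact ⟨hconn, hb, ha, c₂, c₁, h₂, h₁, hdisj.symm, by rw [hcyc, Set.pair_comm], hs₂, hs₁⟩

theorem IsBicyclicEven.two_le_left {S : SignedDigraph V} {a b : ℕ} {ε₁ ε₂ : ℤˣ}
    (h : S.IsBicyclicEven a b ε₁ ε₂) : 2 ≤ a := by
  obtain ⟨-, ha, -, _, -, h₁, -⟩ := h
  exact two_le_of_even_cycle h₁ ha

theorem IsBicyclicEven.add_le {n : ℕ} {S : SignedDigraph (Fin n)} {a b : ℕ} {ε₁ ε₂ : ℤˣ}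
    (h : S.IsBicyclicEven a b ε₁ ε₂) : a + b ≤ n := by
  obtain ⟨-, -, -, c₁, c₂, h₁, h₂, hdisj, -⟩ := h
  have := Fintype.card_le_of_injective _ (h₁.injective.sumElim h₂.injective fun i j hij =>
    Set.disjoint_left.mp hdisj ⟨i, rfl⟩ ⟨j, hij.symm⟩)
  simpa using this

end SignedDigraph

namespace CyclePair

open SignedDigraph

theorem segment_subset_upperChain {m M : ℕ} (hM : 22 ≤ M) (hMm : M ≤ m) (eM : Even M)
    (em : Even m) {p : CyclePair} (hp : p ∈ segment M) : p ∈ upperChain m := by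
  rw [upperChain, List.mem_append, List.mem_flatMap]
  obtain ⟨x, rfl⟩ := eM
  obtain ⟨y, rfl⟩ := em
  refine Or.inr ⟨y - x, List.mem_range.2 (by omega), ?_⟩
  rwa [show y + y - 2 * (y - x) = x + x by omega]

theorem mem_segment {M : ℕ} {p : CyclePair} : p ∈ segment M ↔
    p ∈ posDown M ∨ p = neg 2 (M - 4) ∨ p = pos 4 (M - 4) ∨ p ∈ negDown (M - 2) ∨
      p = pos 2 (M - 2) := by
  simp only [segment, List.mem_append, List.mem_cons, List.not_mem_nil, or_false, or_assoc]

theorem listed_pos {m a b : ℕ} (em : Even m) (ha : 2 ≤ a) (hab : a ≤ b)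
    (ea : Even a) (eb : Even b) (h : a + b ≤ m) : Listed m (pos a b) := by
  rcases Nat.lt_or_ge (a + b) 22 with hs | hs
  · right
    obtain ⟨i, rfl⟩ := ea.two_dvd
    obtain ⟨j, rfl⟩ := eb.two_dvd
    have hi : 1 ≤ i := by omega
    have hi' : i ≤ 5 := by omega
    have hj : j ≤ 10 - i := by omega
    have hij : i ≤ j := by omega
    clear * - hi hi' hj hij
    interval_cases i <;> interval_cases j <;> simp [lowerChain]
  · left
    refine segment_subset_upperChain hs h (ea.add eb) em (mem_segment.2 ?_)
    rcases Nat.lt_or_ge a 6 with h6 | h6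
    · obtain rfl | rfl : a = 2 ∨ a = 4 := by
        obtain ⟨k, rfl⟩ := ea
        omega
      · simp
      · simp
    · exact Or.inl (mem_posDown.2 ⟨a, ea, h6, by omega, by rw [Nat.add_sub_cancel_left]⟩)

/-- A negative pair on fewer than `m` vertices occurs in the segment that belongs to two more
vertices. -/
theorem listed_neg {m a b : ℕ} (hm : 22 ≤ m) (em : Even m) (ha : 2 ≤ a) (hab : a ≤ b)
    (ea : Even a) (eb : Even b) (h : a + b ≤ m) : Listed m (neg a b) := by
  have ha' : 4 ≤ a ∨ a = 2 := by
    obtain ⟨k, rfl⟩ := ea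
    omega
  rcases Nat.lt_or_ge (a + b) 20 with hs | hs
  · right
    obtain ⟨i, rfl⟩ := ea.two_dvd
    obtain ⟨j, rfl⟩ := eb.two_dvd
    have hi : 1 ≤ i := by omega
    have hi' : i ≤ 4 := by omega
    have hj : j ≤ 9 - i := by omega
    have hij : i ≤ j := by omega
    clear * - hi hi' hj hij
    interval_cases i <;> interval_cases j <;> simp [lowerChain]
  · left
    rcases h.eq_or_lt with rfl | hlt
    · rw [upperChain, List.mem_append, List.mem_cons]
      left
      rcases ha' with h4 | rfl
      · exact Or.inr (mem_negDown.2 ⟨a, ea, h4, by omega, by rw [Nat.add_sub_cancel_left]⟩)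
      · left
        rw [Nat.add_sub_cancel_left]
    · have e : Even (a + b + 2) := by grind
      refine segment_subset_upperChain (M := a + b + 2) (by omega) (by grind) e em
        (mem_segment.2 ?_)
      rcases ha' with h4 | rfl
      · refine Or.inr (Or.inr (Or.inr (Or.inl (mem_negDown.2 ⟨a, ea, h4, by omega, ?_⟩))))
        congr 1
        omega
      · right; left
        congr 1
        omega

theorem exists_of_mem_lowerChain : ∀ p ∈ lowerChain.flatten, ∃ a b, (p = pos a b ∨ p = neg a b) ∧
    2 ≤ a ∧ 2 ≤ b ∧ Even a ∧ Even b ∧ a + b ≤ 22 := by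
  simp only [lowerChain, List.flatten_cons, List.flatten_nil, List.cons_append, List.nil_append,
    List.forall_mem_cons, List.not_mem_nil, IsEmpty.forall_iff, implies_true, and_true]
  and_intros <;> first
    | exact ⟨_, _, Or.inl rfl, by decide⟩
    | exact ⟨_, _, Or.inr rfl, by decide⟩

theorem Listed.exists_lengths {m : ℕ} {p : CyclePair} (hm : 22 ≤ m) (em : Even m)
    (hp : Listed m p) : ∃ a b, (p = pos a b ∨ p = neg a b) ∧
      2 ≤ a ∧ 2 ≤ b ∧ Even a ∧ Even b ∧ a + b ≤ m := by
  have hneg : ∀ N, 8 ≤ N → N ≤ m → Even N → p ∈ negDown N → ∃ a b, (p = pos a b ∨ p = neg a b) ∧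
      2 ≤ a ∧ 2 ≤ b ∧ Even a ∧ Even b ∧ a + b ≤ m := by
    intro N h8 hNm eN h
    obtain ⟨a, ea, ha, ha', rfl⟩ := mem_negDown.1 h
    exact ⟨a, N - a, Or.inr rfl, by omega, by omega, ea, by grind, by omega⟩
  rcases hp with hp | hp
  · rw [upperChain, List.mem_append, List.mem_cons, List.mem_flatMap] at hp
    rcases hp with (rfl | hp) | ⟨i, hi, hp⟩
    · exact ⟨2, m - 2, Or.inr rfl, le_rfl, by omega, even_two, by grind, by omega⟩
    · exact hneg m (by omega) le_rfl em hp
    · rw [List.mem_range] at hi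
      have eM : Even (m - 2 * i) := by grind
      have hM : 22 ≤ m - 2 * i := by omega
      have hMm : m - 2 * i ≤ m := by omega
      generalize m - 2 * i = M at *
      rcases mem_segment.1 hp with hp | rfl | rfl | hp | rfl
      · obtain ⟨a, ea, ha, ha', rfl⟩ := mem_posDown.1 hp
        exact ⟨a, M - a, Or.inl rfl, by omega, by omega, ea, by grind, by omega⟩
      · exact ⟨2, M - 4, Or.inr rfl, le_rfl, by omega, even_two, by grind, by omega⟩
      · exact ⟨4, M - 4, Or.inl rfl, by omega, by omega, by decide, by grind, by omega⟩
      · exact hneg _ (by omega) (by omega) (by grind) hp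
      · exact ⟨2, M - 2, Or.inl rfl, le_rfl, by omega, even_two, by grind, by omega⟩
  · obtain ⟨a, b, h, ha, hb, ea, eb, hab⟩ := exists_of_mem_lowerChain p hp
    exact ⟨a, b, h, ha, hb, ea, eb, by omega⟩

theorem exists_listed_of_isBicyclicEven {n m a b : ℕ} {S : SignedDigraph (Fin n)} {ε : ℤˣ}
    (hm : 22 ≤ m) (em : Even m) (hs : S.IsBicyclicEven a b ε ε) (h : a + b ≤ m) :
    ∃ p : CyclePair, Listed m p ∧ p.size ≤ n ∧ p.IsPairOf S := by
  wlog hab : a ≤ b generalizing a b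
  · exact this hs.symm (by omega) (by omega)
  have hn := hs.add_le
  have ha := hs.two_le_left
  have ea : Even a := hs.2.1
  have eb : Even b := hs.2.2.1
  rcases Int.units_eq_one_or ε with rfl | rfl
  · exact ⟨pos a b, listed_pos em ha hab ea eb h, hn, hs⟩
  · exact ⟨neg a b, listed_neg hm em ha hab ea eb h, hn, hs⟩

theorem Listed.exists_isPairOf {n m : ℕ} {p : CyclePair} (hm : 22 ≤ m) (em : Even m)
    (hp : Listed m p) (hn : p.size ≤ n) : ∃ S : SignedDigraph (Fin n), p.IsPairOf S := by
  obtain ⟨a, b, rfl | rfl, ha, hb, ea, eb, -⟩ := hp.exists_lengths hm em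
  · exact ⟨_, isBicyclicEven_pathWithTwoCycles ha hb ea eb hn 1⟩
  · exact ⟨_, isBicyclicEven_pathWithTwoCycles ha hb ea eb hn (-1)⟩

theorem Listed.size_le {m : ℕ} {p : CyclePair} (hm : 22 ≤ m) (em : Even m)
    (hp : Listed m p) : p.size ≤ m := by
  obtain ⟨a, b, rfl | rfl, -, -, -, -, h⟩ := hp.exists_lengths hm em <;> exact h

end CyclePair

theorem theorem3p3 :
    -- the energies in the chains: `E_c(C_r^±)` does not depend on the signs of the single arcs,
    -- and it has the cotangent / cosecant values
    (∀ r : ℕ, 2 ≤ r → Even r →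
      (∀ s : Fin r → ℤˣ, (SignedDigraph.cycle s).iotaEnergy =
        (SignedDigraph.signedCycle r (∏ i, s i)).iotaEnergy) ∧
      (SignedDigraph.signedCycle r 1).iotaEnergy = 2 * Real.cot (Real.pi / r) ∧
      (SignedDigraph.signedCycle r (-1)).iotaEnergy = 2 * (Real.sin (Real.pi / r))⁻¹) ∧
    -- the energy of a bicyclic signed digraph is the one of its pair of cycles
    (∀ (n : ℕ) (S : SignedDigraph (Fin n)) (p : CyclePair), 4 ≤ n → p.IsPairOf S →
      S.iotaEnergy = p.energy) ∧
    -- the chains for `n ≥ 22`, with `m = n` for even `n` and `m = n - 1` for odd `n`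
    (∀ n : ℕ, 22 ≤ n →
      (CyclePair.upperChain (2 * (n / 2))).IsChain (fun p q => p.energy > q.energy)) ∧
    -- the explicit chain: equality inside a level, strict descent from level to level
    (∀ l ∈ CyclePair.lowerChain, ∀ p ∈ l, ∀ q ∈ l, p.energy = q.energy) ∧
    CyclePair.lowerChain.IsChain (fun l l' => ∀ p ∈ l, ∀ q ∈ l', p.energy > q.energy) ∧
    -- the ordering is the whole one for `n ≥ 22`: the bicyclic signed digraphs on `n` vertices
    -- with cycles of equal sign realize the listed pairs, and all of them
    (∀ n : ℕ, 22 ≤ n →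
      (∀ (S : SignedDigraph (Fin n)) (a b : ℕ) (ε : ℤˣ), S.IsBicyclicEven a b ε ε →
        ∃ p : CyclePair, CyclePair.Listed (2 * (n / 2)) p ∧ p.IsPairOf S) ∧
      (∀ p : CyclePair, CyclePair.Listed (2 * (n / 2)) p →
        ∃ S : SignedDigraph (Fin n), p.IsPairOf S)) ∧
    -- the same for `4 ≤ n ≤ 22`, where the pairs with more than `n` vertices are left out
    (∀ n : ℕ, 4 ≤ n → n ≤ 22 →
      (∀ (S : SignedDigraph (Fin n)) (a b : ℕ) (ε : ℤˣ), S.IsBicyclicEven a b ε ε →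
        ∃ p : CyclePair, CyclePair.Listed 22 p ∧ p.size ≤ n ∧ p.IsPairOf S) ∧
      (∀ p : CyclePair, CyclePair.Listed 22 p → p.size ≤ n →
        ∃ S : SignedDigraph (Fin n), p.IsPairOf S)) := by
  refine ⟨fun r hr er => ⟨SignedDigraph.iotaEnergy_cycle_eq_signedCycle hr,
      SignedDigraph.iotaEnergy_signedCycle_one hr er,
      SignedDigraph.iotaEnergy_signedCycle_neg_one hr er⟩,
    fun n S p _ hp => ?_,
    fun n hn => CyclePair.isChain_upperChain (by omega) (even_two_mul _),
    CyclePair.lowerChain_level_eq, CyclePair.isChain_lowerChain,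
    fun n hn => ⟨fun S a b ε hS => ?_, fun p hp => ?_⟩,
    fun n _ hn => ⟨fun S a b ε hS => ?_, fun p hp hpn => ?_⟩⟩
  · cases p <;> exact SignedDigraph.iotaEnergy_of_isBicyclicEven hp
  · have hle := hS.add_le
    -- `a + b` is even, so it is at most the largest even number not above `n`.
    have : a + b ≤ 2 * (n / 2) := by
      obtain ⟨k, hk⟩ := hS.2.1.add hS.2.2.1
      omega
    obtain ⟨p, hp, -, hpS⟩ := CyclePair.exists_listed_of_isBicyclicEven (m := 2 * (n / 2))
      (by omega) (even_two_mul _) hS this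
    exact ⟨p, hp, hpS⟩
  · have := hp.size_le (by omega) (even_two_mul _)
    exact hp.exists_isPairOf (by omega) (even_two_mul _) (by omega)
  · exact CyclePair.exists_listed_of_isBicyclicEven le_rfl (by decide) hS (hS.add_le.trans hn)
  · exact hp.exists_isPairOf le_rfl (by decide) hpn
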